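/- Let $d>2$ and $n\ge 0$ be integers, and let $\mathcal H_n^d$ be the space of real harmonic polynomials on $\mathbb R^d$ that are homogeneous of degree $n$. Let $d\sigma$ be the surface measure on the unit sphere $\mathbb S^{d-1}$, $\omega_d=\sigma(\mathbb S^{d-1})$, and $$\langle f,g\rangle_{\mathbb S^{d-1}}=\frac1{\omega_d}\int_{\mathbb S^{d-1}}f(x)g(x)\,d\sigma(x).$$ Use the spherical polar coordinates $$x_1=r\sin\theta_{d-1}\cdots\sin\theta_2\sin\theta_1,\qquad x_k=r\sin\theta_{d-1}\cdots\sin\theta_{k}\cos\theta_{k-1}\quad(2\le k\le d),$$ (so that $x_d=r\cos\theta_{d-1}$), where $r\ge0$, $0\le\theta_1\le2\pi$ and $0\le\theta_i\le\pi$ for $2\le i\le d-1$. Let $(a)_m=a(a+1)\cdots(a+m-1)$, and for $\lambda>0$ let $$C_m^\lambda(t)=\frac{(\lambda)_m2^m}{m!}\,t^m\,{}_2F_1\!\left(-\tfrac m2,\tfrac{1-m}2;1-m-\lambda;\tfrac1{t^2}\right)=\frac{(\lambda)_m2^m}{m!}\sum_{0\le i\le m/2}\frac{(-\frac m2)_i(\frac{1-m}2)_i}{i!\,(1-m-\lambda)_i}\,t^{m-2i}$$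 be the Gegenbauer polynomial of degree $m$. For $\alpha\in\mathbb N_0^d$ with $\alpha_d\in\{0,1\}$ put $$|\alpha^j|=\alpha_j+\cdots+\alpha_{d-1},\qquad \lambda_j=|\alpha^{j+1}|+\frac{d-j-1}2,$$ let $g_\alpha(\theta_1)=\cos(\alpha_{d-1}\theta_1)$ if $\alpha_d=0$ and $g_\alpha(\theta_1)=\sin(\alpha_{d-1}\theta_1)$ if $\alpha_d=1$, and let $h_\alpha>0$ be given by $$[h_\alpha]^2=b_\alpha\prod_{j=1}^{d-2}\frac{\alpha_j!\,\bigl(\frac{d-j+1}2\bigr)_{|\alpha^{j+1}|}(\alpha_j+\lambda_j)}{(2\lambda_j)_{\alpha_j}\bigl(\frac{d-j}2\bigr)_{|\alpha^{j+1}|}\lambda_j},$$ where $b_\alpha=2$ if $\alpha_{d-1}+\alpha_d>0$ and $b_\alpha=1$ otherwise. Define $$Y_\alpha(x)=h_\alpha\,r^{|\alpha^1|}g_\alpha(\theta_1)\prod_{j=1}^{d-2}(\sin\theta_{d-j})^{|\alpha^{j+1}|}C_{\alpha_j}^{\lambda_j}(\cos\theta_{d-j}).$$ Then the functions $Y_\alpha$,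 where $\alpha$ ranges over all $\alpha\in\mathbb N_0^d$ with $|\alpha^1|=\alpha_1+\cdots+\alpha_{d-1}=n$, $\alpha_d\in\{0,1\}$, and $\alpha_{d-1}\ge1$ whenever $\alpha_d=1$, form an orthonormal basis of $\mathcal H_n^d$: each $Y_\alpha$ is (the function given by) an element of $\mathcal H_n^d$, these elements form a basis of $\mathcal H_n^d$, and $\langle Y_\alpha,Y_\beta\rangle_{\mathbb S^{d-1}}=\delta_{\alpha,\beta}$. -/

import Mathlib

open MeasureTheory

noncomputable section

namespace SphericalHarmonics

/-- The Laplacian `∂₁² + ⋯ + ∂_d²` on real polynomials in `d` variables. -/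
def laplacian (d : ℕ) : MvPolynomial (Fin d) ℝ →ₗ[ℝ] MvPolynomial (Fin d) ℝ :=
  ∑ i : Fin d, (MvPolynomial.pderiv i).toLinearMap ∘ₗ (MvPolynomial.pderiv i).toLinearMap

/-- `𝓗_n^d`: the real harmonic polynomials on `ℝ^d`, homogeneous of degree `n`. -/
def harmonicSubmodule (d n : ℕ) : Submodule ℝ (MvPolynomial (Fin d) ℝ) :=
  MvPolynomial.homogeneousSubmodule (Fin d) ℝ n ⊓ LinearMap.ker (laplacian d)

/-- The surface measure `σ` on the unit sphere of `ℝ^d`. -/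
def surfaceMeasure (d : ℕ) : Measure (Metric.sphere (0 : EuclideanSpace ℝ (Fin d)) 1) :=
  (volume : Measure (EuclideanSpace ℝ (Fin d))).toSphere

/-- The normalized inner product `⟨p, q⟩ = ω_d⁻¹ ∫ p q dσ` over the unit sphere of `ℝ^d`,
where `ω_d = σ(S^{d-1})` is the surface area. -/
def sphereInner (d : ℕ) (p q : MvPolynomial (Fin d) ℝ) : ℝ :=
  ((surfaceMeasure d).real Set.univ)⁻¹ *
    ∫ x : Metric.sphere (0 : EuclideanSpace ℝ (Fin d)) 1,
      MvPolynomial.eval (x : EuclideanSpace ℝ (Fin d)).ofLp p *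
        MvPolynomial.eval (x : EuclideanSpace ℝ (Fin d)).ofLp q ∂(surfaceMeasure d)

/-- The entry `v_j` of `v = (v_1, …, v_k)`, counted from `1` (and `0` when `j` is not in
`{1, …, k}`). -/
def entry {M : Type*} [Zero M] {k : ℕ} (v : Fin k → M) (j : ℕ) : M :=
  if h : 1 ≤ j ∧ j ≤ k then v ⟨j - 1, by omega⟩ else 0

/-- The admissible angles `θ = (θ_1, …, θ_{d-1})`:
`0 ≤ θ_1 ≤ 2π` and `0 ≤ θ_k ≤ π` for `2 ≤ k ≤ d - 1`. -/
def angleDomain (d : ℕ) : Set (Fin (d - 1) → ℝ) :=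
  {θ | (0 ≤ entry θ 1 ∧ entry θ 1 ≤ 2 * Real.pi) ∧
    ∀ k, 2 ≤ k → k ≤ d - 1 → 0 ≤ entry θ k ∧ entry θ k ≤ Real.pi}

/-- The point with spherical polar coordinates `(r, θ)`:
`x_1 = r sin θ_{d-1} ⋯ sin θ_1` and, for `2 ≤ k ≤ d`,
`x_k = r sin θ_{d-1} ⋯ sin θ_k cos θ_{k-1}`.
The variable `i : Fin d` stands for `k = i + 1`. -/
def sphericalPoint (d : ℕ) (r : ℝ) (θ : Fin (d - 1) → ℝ) : Fin d → ℝ := fun i =>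
  if (i : ℕ) = 0 then r * ∏ k ∈ Finset.Icc 1 (d - 1), Real.sin (entry θ k)
  else r * (∏ k ∈ Finset.Icc ((i : ℕ) + 1) (d - 1), Real.sin (entry θ k)) *
    Real.cos (entry θ (i : ℕ))

/-- The Pochhammer symbol `(a)_n = a (a + 1) ⋯ (a + n - 1)`. -/
def poch (a : ℝ) (n : ℕ) : ℝ := (ascPochhammer ℝ n).eval a

/-- The Gegenbauer polynomial
`C_n^μ(x) = (μ)_n 2^n / n! · x^n · ₂F₁(-n/2, (1-n)/2; 1-n-μ; 1/x²)`, for `μ > 0`. The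
hypergeometric series terminates at `j = ⌊n/2⌋`; the factor `x^n` is multiplied into it, so that
the formula is also correct at `x = 0`. -/
def gegenbauer (n : ℕ) (μ x : ℝ) : ℝ :=
  poch μ n * 2 ^ n / n.factorial *
    ∑ j ∈ Finset.range (n / 2 + 1),
      poch (-(n : ℝ) / 2) j * poch ((1 - (n : ℝ)) / 2) j /
        (j.factorial * poch (1 - (n : ℝ) - μ) j) * x ^ (n - 2 * j)

/-- `|α^j| = α_j + ⋯ + α_{d-1}`; the last entry `α_d` is not counted. -/
def tailSum {d : ℕ} (α : Fin d → ℕ) (j : ℕ) : ℕ := ∑ i ∈ Finset.Icc j (d - 1), entry α i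

/-- `λ_j = |α^{j+1}| + (d - j - 1) / 2`. -/
def lam {d : ℕ} (α : Fin d → ℕ) (j : ℕ) : ℝ := tailSum α (j + 1) + ((d : ℝ) - j - 1) / 2

/-- `[h_α]²`, with `b_α = 2` if `α_{d-1} + α_d > 0` and `b_α = 1` otherwise. -/
def hSq {d : ℕ} (α : Fin d → ℕ) : ℝ :=
  (if 0 < entry α (d - 1) + entry α d then 2 else 1) *
    ∏ j ∈ Finset.Icc 1 (d - 2),
      ((entry α j).factorial * poch (((d : ℝ) - j + 1) / 2) (tailSum α (j + 1)) *
          (((entry α j : ℕ) : ℝ) + lam α j)) /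
        (poch (2 * lam α j) (entry α j) * poch (((d : ℝ) - j) / 2) (tailSum α (j + 1)) * lam α j)

/-- The normalizing constant `h_α > 0`. -/
def h {d : ℕ} (α : Fin d → ℕ) : ℝ := Real.sqrt (hSq α)

/-- `g_α(θ_1)`: `cos (α_{d-1} θ_1)` if `α_d = 0`, and `sin (α_{d-1} θ_1)` if `α_d = 1`
(only these two values of `α_d` are used). -/
def g {d : ℕ} (α : Fin d → ℕ) (t : ℝ) : ℝ :=
  if entry α d = 0 then Real.cos (entry α (d - 1) * t) else Real.sin (entry α (d - 1) * t)

/-- The function `Y_α` in spherical coordinates `(r, θ)`; it has degree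
`|α^1| = α_1 + ⋯ + α_{d-1}`. -/
def Y {d : ℕ} (α : Fin d → ℕ) (r : ℝ) (θ : Fin (d - 1) → ℝ) : ℝ :=
  h α * r ^ tailSum α 1 * g α (entry θ 1) *
    ∏ j ∈ Finset.Icc 1 (d - 2),
      Real.sin (entry θ (d - j)) ^ tailSum α (j + 1) *
        gegenbauer (entry α j) (lam α j) (Real.cos (entry θ (d - j)))

/-- The indices of degree `n`: multi-indices `α ∈ ℕ₀^d` with `α_1 + ⋯ + α_{d-1} = n` whose last
entry is a label, `0` (cosine) or `1` (sine); the sine label requires `α_{d-1} ≥ 1`, since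
`sin (0 · θ_1)` vanishes identically. -/
def Index (d n : ℕ) : Type :=
  {α : Fin d → ℕ // tailSum α 1 = n ∧
    (entry α d = 0 ∨ (entry α d = 1 ∧ 1 ≤ entry α (d - 1)))}

end SphericalHarmonics

end

/-! The functions `Y_α` are built one variable at a time. In the plane, take the real or imaginary
part of `(x_2 + i x_1)^m`. To pass from `k` to `k + 1` variables, multiply a harmonic polynomial of
degree `N` by the homogenized Gegenbauer polynomial `ρ^a C_a^μ(x_{k+1} / ρ)`, with `ρ² = x_1² + ⋯ +
x_{k+1}²`. The product is harmonic exactly because `μ = N + (k - 1)/2`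
(`IsHarmonicOfDegree.homGegenbauer_mul`). In spherical coordinates these products are the stated
formula (`eval_harmonicFactor_sphericalPoint`).

On homogeneous polynomials of degree `n`, the sphere inner product is `E(pq) / E(|x|^{2n})` for the
standard Gaussian expectation `E` (`sphereInner_eq`). After that only `E 1 = 1` and `E(x_i p) =
E(∂_i p)` are needed. Orthogonality: harmonic polynomials in `k` variables of different degrees stay
orthogonal after multiplication by any polynomial in `x_1² + ⋯ + x_k²` and the later variables
(`IsGaussian.harmonic_mul_eq_zero`). The remaining case, cosine against sine, uses the rotation
field. Norms follow from a recursion in the Gegenbauer degree (`IsGaussian.homGegenbauer_mul_sq`),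
which telescopes against `[h_α]²`.

Orthonormality gives linear independence. For spanning, a harmonic polynomial is determined by its
coefficients at monomials of degree at most one in `x_d` (`eq_zero_of_laplacian_eq_zero`), and these
are matched with indices, so the dimension is at most the number of indices. -/

noncomputable section

namespace SphericalHarmonics

open MvPolynomial Finset

/-! ### Differential operators in the first `k` variables -/

/-- The `k`-th variable, counted from `0` (and `0` when `d ≤ k`). -/
def coordVar (d k : ℕ) : MvPolynomial (Fin d) ℝ := if h : k < d then X ⟨k, h⟩ else 0

/-- The derivation along the `k`-th variable, counted from `0` (and `0` when `d ≤ k`). -/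
def coordDeriv (d k : ℕ) : Derivation ℝ (MvPolynomial (Fin d) ℝ) (MvPolynomial (Fin d) ℝ) :=
  if h : k < d then pderiv ⟨k, h⟩ else 0

/-- The sum of the squares of the first `k` variables. -/
def partialNormSq (d k : ℕ) : MvPolynomial (Fin d) ℝ := ∑ i ∈ range k, coordVar d i ^ 2

/-- The Laplacian in the first `k` variables. -/
def partialLaplacian (d k : ℕ) (p : MvPolynomial (Fin d) ℝ) : MvPolynomial (Fin d) ℝ :=
  ∑ i ∈ range k, coordDeriv d i (coordDeriv d i p)

/-- The Euler operator in the first `k` variables. -/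
def partialEuler (d k : ℕ) : Derivation ℝ (MvPolynomial (Fin d) ℝ) (MvPolynomial (Fin d) ℝ) :=
  ∑ i ∈ range k, coordVar d i • coordDeriv d i

variable {d : ℕ}

theorem coordDeriv_coordVar (i j : ℕ) :
    coordDeriv d i (coordVar d j) = if i = j ∧ i < d then 1 else 0 := by
  unfold coordDeriv coordVar
  by_cases hi : i < d <;> by_cases hj : j < d
  · by_cases hij : i = j
    · subst hij; simp [hi]
    · simp only [hi, hj, dite_true, hij, false_and, if_false]
      rw [pderiv_X_of_ne]
      simpa [Fin.ext_iff] using Ne.symm hij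
  · have : i ≠ j := fun h => hj (h ▸ hi)
    simp [hi, hj, this]
  all_goals simp [hi]

theorem coordDeriv_coordVar_self {i : ℕ} (hi : i < d) : coordDeriv d i (coordVar d i) = 1 := by
  simp [coordDeriv_coordVar, hi]

theorem coordDeriv_coordVar_of_ne {i j : ℕ} (hij : i ≠ j) :
    coordDeriv d i (coordVar d j) = 0 := by
  simp [coordDeriv_coordVar, hij]

theorem coordDeriv_comm (i j : ℕ) (p : MvPolynomial (Fin d) ℝ) :
    coordDeriv d i (coordDeriv d j p) = coordDeriv d j (coordDeriv d i p) := by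
  have h : ⁅coordDeriv d i, coordDeriv d j⁆ = 0 := by
    apply MvPolynomial.derivation_ext
    intro k
    have hk : (X k : MvPolynomial (Fin d) ℝ) = coordVar d k := by simp [coordVar]
    rw [Derivation.commutator_apply, hk, coordDeriv_coordVar, coordDeriv_coordVar]
    split_ifs <;> simp
  have := congrArg (fun D => D p) h
  rw [Derivation.commutator_apply] at this
  exact sub_eq_zero.1 this

theorem laplacian_eq_partialLaplacian (p : MvPolynomial (Fin d) ℝ) :
    laplacian d p = partialLaplacian d d p := by
  unfold laplacian partialLaplacian
  rw [LinearMap.sum_apply, Finset.sum_range]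
  refine Finset.sum_congr rfl fun i _ => ?_
  simp [coordDeriv]

theorem partialEuler_apply (k : ℕ) (p : MvPolynomial (Fin d) ℝ) :
    partialEuler d k p = ∑ i ∈ range k, coordVar d i * coordDeriv d i p := by
  unfold partialEuler
  rw [← Derivation.coeFnAddMonoidHom_apply, map_sum, Finset.sum_apply]
  rfl

theorem coordDeriv_partialNormSq {i k : ℕ} (hi : i < k) (hk : k ≤ d) :
    coordDeriv d i (partialNormSq d k) = 2 * coordVar d i := by
  unfold partialNormSq
  rw [map_sum, Finset.sum_eq_single i]
  · rw [Derivation.leibniz_pow, coordDeriv_coordVar_self (hi.trans_le hk)]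
    simp [two_mul]
  · intro j _ hj
    rw [Derivation.leibniz_pow, coordDeriv_coordVar_of_ne hj.symm]
    simp
  · simp [hi]

theorem coordDeriv_partialNormSq_of_le {i k : ℕ} (hi : k ≤ i) :
    coordDeriv d i (partialNormSq d k) = 0 := by
  unfold partialNormSq
  rw [map_sum]
  refine Finset.sum_eq_zero fun j hj => ?_
  rw [Derivation.leibniz_pow, coordDeriv_coordVar_of_ne (by have := mem_range.1 hj; omega)]
  simp

theorem partialEuler_coordVar {i k : ℕ} (hi : i < k) (hk : k ≤ d) :
    partialEuler d k (coordVar d i) = coordVar d i := by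
  rw [partialEuler_apply, Finset.sum_eq_single i]
  · rw [coordDeriv_coordVar_self (hi.trans_le hk), mul_one]
  · intro j _ hj
    rw [coordDeriv_coordVar_of_ne hj, mul_zero]
  · simp [hi]

theorem partialEuler_eq_zero {k : ℕ} {p : MvPolynomial (Fin d) ℝ}
    (hp : ∀ i < k, coordDeriv d i p = 0) : partialEuler d k p = 0 := by
  rw [partialEuler_apply]
  exact Finset.sum_eq_zero fun i hi => by rw [hp i (mem_range.1 hi), mul_zero]

theorem partialEuler_partialNormSq {k : ℕ} (hk : k ≤ d) :
    partialEuler d k (partialNormSq d k) = (2 : ℝ) • partialNormSq d k := by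
  rw [partialEuler_apply, partialNormSq, Finset.smul_sum, ← partialNormSq]
  refine Finset.sum_congr rfl fun i hi => ?_
  rw [coordDeriv_partialNormSq (mem_range.1 hi) hk, ofNat_smul_eq_nsmul]
  ring

theorem partialEuler_mul {k : ℕ} {p q : MvPolynomial (Fin d) ℝ} {a b : ℝ}
    (hp : partialEuler d k p = a • p) (hq : partialEuler d k q = b • q) :
    partialEuler d k (p * q) = (a + b) • (p * q) := by
  rw [Derivation.leibniz, hp, hq]
  simp only [smul_eq_mul, mul_smul_comm, add_smul]
  rw [mul_comm q p, add_comm]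

theorem partialLaplacian_add (k : ℕ) (p q : MvPolynomial (Fin d) ℝ) :
    partialLaplacian d k (p + q) = partialLaplacian d k p + partialLaplacian d k q := by
  simp [partialLaplacian, Finset.sum_add_distrib]

theorem partialLaplacian_smul (k : ℕ) (a : ℝ) (p : MvPolynomial (Fin d) ℝ) :
    partialLaplacian d k (a • p) = a • partialLaplacian d k p := by
  simp [partialLaplacian, Finset.smul_sum]

theorem partialLaplacian_mul (k : ℕ) (p q : MvPolynomial (Fin d) ℝ) :
    partialLaplacian d k (p * q) = p * partialLaplacian d k q + q * partialLaplacian d k p +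
      2 * ∑ i ∈ range k, coordDeriv d i p * coordDeriv d i q := by
  simp only [partialLaplacian, Finset.mul_sum, ← Finset.sum_add_distrib]
  refine Finset.sum_congr rfl fun i _ => ?_
  simp only [Derivation.leibniz, map_add, smul_eq_mul]
  ring

theorem partialLaplacian_coordVar_mul {i k : ℕ} (hi : i < k) (hk : k ≤ d)
    (p : MvPolynomial (Fin d) ℝ) :
    partialLaplacian d k (coordVar d i * p) =
      coordVar d i * partialLaplacian d k p + 2 * coordDeriv d i p := by
  have h0 : partialLaplacian d k (coordVar d i) = 0 := by
    refine Finset.sum_eq_zero fun j _ => ?_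
    rw [coordDeriv_coordVar]
    split_ifs <;> simp
  have h1 : ∑ j ∈ range k, coordDeriv d j (coordVar d i) * coordDeriv d j p =
      coordDeriv d i p := by
    rw [Finset.sum_eq_single i]
    · rw [coordDeriv_coordVar_self (hi.trans_le hk), one_mul]
    · intro j _ hj
      rw [coordDeriv_coordVar_of_ne hj, zero_mul]
    · simp [hi]
  rw [partialLaplacian_mul, h0, h1]
  ring

theorem partialLaplacian_partialNormSq_mul {k : ℕ} (hk : k ≤ d) (p : MvPolynomial (Fin d) ℝ) :
    partialLaplacian d k (partialNormSq d k * p) =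
      partialNormSq d k * partialLaplacian d k p + (2 * k : ℝ) • p +
        (4 : ℝ) • partialEuler d k p := by
  have h0 : partialLaplacian d k (partialNormSq d k) = C (2 * k : ℝ) := by
    have : ∀ i ∈ range k, coordDeriv d i (coordDeriv d i (partialNormSq d k)) = C 2 := by
      intro i hi
      have hi := mem_range.1 hi
      rw [coordDeriv_partialNormSq hi hk, Derivation.leibniz,
        coordDeriv_coordVar_self (hi.trans_le hk)]
      have : coordDeriv d i (2 : MvPolynomial (Fin d) ℝ) = 0 := by
        simpa using (coordDeriv d i).map_natCast 2
      rw [this, map_ofNat]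
      simp
    rw [partialLaplacian, Finset.sum_congr rfl this]
    simp [mul_comm]
  have h1 : ∑ j ∈ range k, coordDeriv d j (partialNormSq d k) * coordDeriv d j p =
      2 * partialEuler d k p := by
    rw [partialEuler_apply, Finset.mul_sum]
    refine Finset.sum_congr rfl fun i hi => ?_
    rw [coordDeriv_partialNormSq (mem_range.1 hi) hk, mul_assoc]
  rw [partialLaplacian_mul, h0, h1, ← C_mul', ← C_mul', map_ofNat]
  ring

/-- `p` depends only on the first `k` variables, is harmonic, and is homogeneous of degree `N`. -/
structure IsHarmonicOfDegree (k N : ℕ) (p : MvPolynomial (Fin d) ℝ) : Prop where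
  coordDeriv_eq_zero : ∀ i, k ≤ i → coordDeriv d i p = 0
  laplacian_eq_zero : partialLaplacian d k p = 0
  euler : partialEuler d k p = (N : ℝ) • p
  isHomogeneous : p.IsHomogeneous N

theorem coordVar_isHomogeneous (i : ℕ) : (coordVar d i).IsHomogeneous 1 := by
  unfold coordVar
  split_ifs
  · exact isHomogeneous_X _ _
  · exact isHomogeneous_zero _ _ _

theorem partialNormSq_isHomogeneous (k : ℕ) : (partialNormSq d k).IsHomogeneous 2 :=
  IsHomogeneous.sum _ _ _ fun i _ => (coordVar_isHomogeneous i).pow 2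

/-! ### Homogeneous Gegenbauer polynomials and the addition of one variable -/

/-- The homogeneous Gegenbauer polynomials `s^{a/2} C_a^μ(t / √s)`, by their recurrence. -/
def homGegenbauer {A : Type*} [CommRing A] [Algebra ℝ A] (μ : ℝ) (s t : A) : ℕ → A
  | 0 => 1
  | 1 => (2 * μ) • t
  | a + 2 => ((a : ℝ) + 2)⁻¹ • ((2 * (a + 1 + μ)) • (t * homGegenbauer μ s t (a + 1)) -
      (a + 2 * μ) • (s * homGegenbauer μ s t a))

section Gegenbauer

variable {A : Type*} [CommRing A] [Algebra ℝ A] (μ : ℝ) (s t : A)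

theorem homGegenbauer_zero : homGegenbauer μ s t 0 = 1 := by rw [homGegenbauer]

theorem homGegenbauer_one : homGegenbauer μ s t 1 = (2 * μ) • t := by rw [homGegenbauer]

theorem homGegenbauer_succ_succ (a : ℕ) :
    homGegenbauer μ s t (a + 2) =
      ((a : ℝ) + 2)⁻¹ • ((2 * (a + 1 + μ)) • (t * homGegenbauer μ s t (a + 1)) -
        (a + 2 * μ) • (s * homGegenbauer μ s t a)) := by rw [homGegenbauer]

theorem homGegenbauer_recurrence (a : ℕ) :
    ((a : ℝ) + 2) • homGegenbauer μ s t (a + 2) =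
      (2 * (a + 1 + μ)) • (t * homGegenbauer μ s t (a + 1)) -
        (a + 2 * μ) • (s * homGegenbauer μ s t a) := by
  rw [homGegenbauer_succ_succ, smul_inv_smul₀ (by positivity)]

/-- The recurrence makes sense in any `ℝ`-algebra, so evaluation at a point turns the polynomial
version into the real-valued one. -/
theorem map_homGegenbauer {B : Type*} [CommRing B] [Algebra ℝ B] (φ : A →ₐ[ℝ] B) (a : ℕ) :
    φ (homGegenbauer μ s t a) = homGegenbauer μ (φ s) (φ t) a := by
  induction a using Nat.twoStepInduction with
  | zero => simp [homGegenbauer_zero]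
  | one => simp [homGegenbauer_one]
  | more a h0 h1 => simp [homGegenbauer_succ_succ, h0, h1]

theorem homGegenbauer_mem_subalgebra (S : Subalgebra ℝ A) (hs : s ∈ S) (ht : t ∈ S) (a : ℕ) :
    homGegenbauer μ s t a ∈ S := by
  induction a using Nat.twoStepInduction with
  | zero => rw [homGegenbauer_zero]; exact S.one_mem
  | one => rw [homGegenbauer_one]; exact S.smul_mem ht _
  | more a h0 h1 =>
    rw [homGegenbauer_succ_succ]
    exact S.smul_mem (S.sub_mem (S.smul_mem (S.mul_mem ht h1) _)
      (S.smul_mem (S.mul_mem hs h0) _)) _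

theorem derivation_homGegenbauer_eq_zero (D : Derivation ℝ A A) (hs : D s = 0) (ht : D t = 0)
    (a : ℕ) : D (homGegenbauer μ s t a) = 0 := by
  induction a using Nat.twoStepInduction with
  | zero => simp [homGegenbauer_zero]
  | one => simp [homGegenbauer_one, ht]
  | more a h0 h1 => simp [homGegenbauer_succ_succ, h0, h1, hs, ht]

/-- The derivative of a Gegenbauer polynomial along the axis, with the same parameter. -/
theorem derivation_homGegenbauer (D : Derivation ℝ A A) (hs : D s = 2 * t) (ht : D t = 1)
    (a : ℕ) :
    D (homGegenbauer μ s t (a + 1)) = (a + 2 * μ) • homGegenbauer μ s t a := by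
  induction a using Nat.twoStepInduction with
  | zero => simp [homGegenbauer_zero, homGegenbauer_one, ht]
  | one =>
    have e := congrArg D (homGegenbauer_recurrence μ s t 0)
    simp only [Derivation.map_smul, map_sub, Derivation.leibniz, hs, ht, smul_eq_mul,
      homGegenbauer_zero, zero_add, homGegenbauer_one, Derivation.map_one_eq_zero, Nat.cast_zero]
      at e
    have hu : IsUnit (algebraMap ℝ A 2) := (isUnit_iff_ne_zero.2 two_ne_zero).map _
    apply hu.mul_left_cancel
    simp only [Nat.reduceAdd, homGegenbauer_one, Nat.cast_one]
    simp only [Algebra.smul_def, map_one, map_add, map_mul, map_ofNat] at e ⊢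
    linear_combination e
  | more a h0 h1 =>
    -- After differentiating the recurrence for degree `a + 3`, the terms in degrees `a + 1` and `a`
    -- recombine by the recurrence for degree `a + 2`.
    have r1 := homGegenbauer_recurrence μ s t a
    have e := congrArg D (homGegenbauer_recurrence μ s t (a + 1))
    simp only [Derivation.map_smul, map_sub, Derivation.leibniz, hs, ht, smul_eq_mul, h0, h1] at e
    have hu : IsUnit (algebraMap ℝ A ((a : ℝ) + 3)) :=
      (isUnit_iff_ne_zero.2 (by positivity)).map _
    apply hu.mul_left_cancel
    simp only [Algebra.smul_def, map_one, map_add, map_mul, map_ofNat, map_natCast, Nat.cast_add,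
      Nat.cast_one, Nat.cast_ofNat] at e r1 ⊢
    linear_combination e - ((a : A) + 1 + 2 * algebraMap ℝ A μ) * r1

end Gegenbauer

theorem coordDeriv_homGegenbauer_mul {k : ℕ} (hk : k < d) {q : MvPolynomial (Fin d) ℝ}
    (hq : coordDeriv d k q = 0) (μ : ℝ) (a : ℕ) :
    coordDeriv d k (homGegenbauer μ (partialNormSq d (k + 1)) (coordVar d k) (a + 1) * q) =
      (a + 2 * μ) • (homGegenbauer μ (partialNormSq d (k + 1)) (coordVar d k) a * q) := by
  rw [Derivation.leibniz, hq, derivation_homGegenbauer _ _ _ _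
    (coordDeriv_partialNormSq (Nat.lt_succ_self k) hk) (coordDeriv_coordVar_self hk)]
  simp [mul_comm q]

theorem homGegenbauer_mul_recurrence {A : Type*} [CommRing A] [Algebra ℝ A] (μ : ℝ) (s t q : A)
    (a : ℕ) :
    homGegenbauer μ s t (a + 2) * q = ((a : ℝ) + 2)⁻¹ •
      ((2 * (a + 1 + μ)) • (t * (homGegenbauer μ s t (a + 1) * q)) -
        (a + 2 * μ) • (s * (homGegenbauer μ s t a * q))) := by
  rw [homGegenbauer_succ_succ]
  simp only [smul_mul_assoc, sub_mul, mul_assoc]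

/-- Adding one variable: a homogeneous Gegenbauer polynomial with the right parameter times a
harmonic polynomial in the first `k` variables is harmonic in the first `k + 1` variables. -/
theorem IsHarmonicOfDegree.homGegenbauer_mul {k N : ℕ} (hk : k < d) {q : MvPolynomial (Fin d) ℝ}
    (hq : IsHarmonicOfDegree k N q) {μ : ℝ} (hμ : μ = N + ((k : ℝ) - 1) / 2) (a : ℕ) :
    IsHarmonicOfDegree (k + 1) (a + N)
      (homGegenbauer μ (partialNormSq d (k + 1)) (coordVar d k) a * q) := by
  have hqk : coordDeriv d k q = 0 := hq.coordDeriv_eq_zero k le_rfl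
  have hlap : partialLaplacian d (k + 1) q = 0 := by
    rw [partialLaplacian, Finset.sum_range_succ, ← partialLaplacian, hq.laplacian_eq_zero, hqk]
    simp
  have heul : partialEuler d (k + 1) q = (N : ℝ) • q := by
    rw [partialEuler_apply, Finset.sum_range_succ, ← partialEuler_apply, hq.euler, hqk]
    simp
  have ht : partialEuler d (k + 1) (coordVar d k) = (1 : ℝ) • coordVar d k := by
    rw [partialEuler_coordVar (Nat.lt_succ_self k) hk, one_smul]
  have hs := partialEuler_partialNormSq (d := d) (k := k + 1) hk
  have hind : ∀ i, k + 1 ≤ i → coordDeriv d i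
      (homGegenbauer μ (partialNormSq d (k + 1)) (coordVar d k) a * q) = 0 := by
    intro i hi
    rw [Derivation.leibniz, hq.coordDeriv_eq_zero i (by omega), derivation_homGegenbauer_eq_zero _ _
      _ _ (coordDeriv_partialNormSq_of_le hi) (coordDeriv_coordVar_of_ne (by omega))]
    simp
  have hder := coordDeriv_homGegenbauer_mul hk hqk μ
  -- The three properties are proved together because the Laplacian of `s * p` involves the Euler
  -- degree of `p`.
  suffices H : partialLaplacian d (k + 1)
        (homGegenbauer μ (partialNormSq d (k + 1)) (coordVar d k) a * q) = 0 ∧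
      partialEuler d (k + 1) (homGegenbauer μ (partialNormSq d (k + 1)) (coordVar d k) a * q) =
        ((a : ℝ) + N) • (homGegenbauer μ (partialNormSq d (k + 1)) (coordVar d k) a * q) ∧
      (homGegenbauer μ (partialNormSq d (k + 1)) (coordVar d k) a * q).IsHomogeneous (a + N) by
    exact ⟨hind, H.1, by rw [H.2.1, Nat.cast_add], H.2.2⟩
  clear hind
  induction a using Nat.twoStepInduction with
  | zero =>
    rw [homGegenbauer_zero, one_mul]
    exact ⟨hlap, by simp [heul], by simpa using hq.isHomogeneous⟩
  | one =>
    rw [homGegenbauer_one, smul_mul_assoc]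
    refine ⟨?_, ?_, ?_⟩
    · rw [partialLaplacian_smul, partialLaplacian_coordVar_mul (Nat.lt_succ_self k) hk, hlap, hqk]
      simp
    · rw [Derivation.map_smul, partialEuler_mul ht heul, smul_comm, Nat.cast_one]
    · rw [← C_mul']
      simpa using (isHomogeneous_C _ (2 * μ)).mul
        ((coordVar_isHomogeneous k).mul hq.isHomogeneous)
  | more a h0 h1 =>
    rw [homGegenbauer_mul_recurrence]
    have hd1 := hder a
    generalize homGegenbauer μ (partialNormSq d (k + 1)) (coordVar d k) (a + 1) * q = p1 at *
    generalize homGegenbauer μ (partialNormSq d (k + 1)) (coordVar d k) a * q = p0 at *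
    refine ⟨?_, ?_, ?_⟩
    · rw [partialLaplacian_smul, sub_eq_add_neg, partialLaplacian_add, ← neg_smul,
        partialLaplacian_smul, partialLaplacian_smul,
        partialLaplacian_coordVar_mul (Nat.lt_succ_self k) hk,
        partialLaplacian_partialNormSq_mul (by omega), h0.1, h1.1, h0.2.1, hd1, hμ]
      simp only [← C_mul', map_add, map_mul, map_ofNat, map_natCast, map_neg, map_one,
        Nat.cast_add, Nat.cast_one]
      -- Up to the common factor `1/(a + 2)`, the two Laplacians contribute `4(a + 1 + μ)(a + 2μ)
      -- p0` and `-(a + 2μ)(2(k + 1) + 4(a + N)) p0`; they cancel since `2μ = 2N + k - 1`.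
      have h2 : (C (((k : ℝ) - 1) / 2) : MvPolynomial (Fin d) ℝ) * 2 = (k : MvPolynomial (Fin d) ℝ) - 1 := by
        rw [← map_ofNat C 2, ← map_mul, div_mul_cancel₀ _ two_ne_zero]
        simp
      linear_combination (C (((a : ℝ) + 2)⁻¹) * p0 * 2 *
        ((a : MvPolynomial (Fin d) ℝ) + 2 * (N + C (((k : ℝ) - 1) / 2)))) * h2
    · have e1 := partialEuler_mul ht h1.2.1
      have e0 := partialEuler_mul hs h0.2.1
      rw [Derivation.map_smul, map_sub, Derivation.map_smul, Derivation.map_smul, e1, e0]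
      push_cast
      module
    · have e1 := (coordVar_isHomogeneous k).mul h1.2.2
      have e0 := (partialNormSq_isHomogeneous (k + 1)).mul h0.2.2
      rw [show 1 + (a + 1 + N) = a + 2 + N by ring] at e1
      rw [show 2 + (a + N) = a + 2 + N by ring] at e0
      have key : ∀ (c : ℝ) {p : MvPolynomial (Fin d) ℝ}, p.IsHomogeneous (a + 2 + N) →
          (c • p).IsHomogeneous (a + 2 + N) := fun c p hp => by
        rw [← C_mul']
        simpa using (isHomogeneous_C _ c).mul hp
      exact key _ ((key _ e1).sub (key _ e0))

/-! ### Pochhammer symbols and Gaussian integration by parts -/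

theorem poch_zero (a : ℝ) : poch a 0 = 1 := by simp [poch]

theorem poch_succ (a : ℝ) (n : ℕ) : poch a (n + 1) = poch a n * (a + n) := by
  rw [poch, ascPochhammer_succ_eval, poch]

theorem poch_pos {a : ℝ} (ha : 0 < a) (n : ℕ) : 0 < poch a n := ascPochhammer_pos n a ha

theorem poch_add (a : ℝ) (m n : ℕ) : poch a (m + n) = poch a m * poch (a + m) n := by
  induction n with
  | zero => simp [poch_zero]
  | succ n ih => rw [← add_assoc, poch_succ, ih, poch_succ]; push_cast; ring

theorem poch_mul_add (a : ℝ) (n : ℕ) : poch a n * (a + n) = a * poch (a + 1) n := by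
  rw [← poch_succ, add_comm, poch_add, Nat.cast_one]
  simp [poch_succ, poch_zero]

/-- A normalized linear functional on polynomials that satisfies the integration by parts formula
of the standard Gaussian measure. -/
structure IsGaussian (E : MvPolynomial (Fin d) ℝ →ₗ[ℝ] ℝ) : Prop where
  one : E 1 = 1
  coordVar_mul : ∀ i p, E (coordVar d i * p) = E (coordDeriv d i p)

namespace IsGaussian

variable {E : MvPolynomial (Fin d) ℝ →ₗ[ℝ] ℝ}

theorem partialNormSq_mul (hE : IsGaussian E) {k : ℕ} (hk : k ≤ d) {p : MvPolynomial (Fin d) ℝ}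
    {m : ℝ} (hp : partialEuler d k p = m • p) : E (partialNormSq d k * p) = (k + m) * E p := by
  have h : ∀ i ∈ range k, E (coordVar d i ^ 2 * p) = E p + E (coordVar d i * coordDeriv d i p) := by
    intro i hi
    rw [pow_two, mul_assoc, hE.coordVar_mul, Derivation.leibniz,
      coordDeriv_coordVar_self ((mem_range.1 hi).trans_le hk), map_add, add_comm]
    simp
  rw [partialNormSq, Finset.sum_mul, map_sum, Finset.sum_congr rfl h, Finset.sum_add_distrib,
    ← map_sum E fun i => coordVar d i * coordDeriv d i p, ← partialEuler_apply, hp, map_smul, smul_eq_mul, add_mul]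
  simp

theorem partialNormSq_pow (hE : IsGaussian E) {k : ℕ} (hk : k ≤ d) (n : ℕ) :
    E (partialNormSq d k ^ n) = 2 ^ n * poch (k / 2) n := by
  have heul : ∀ n : ℕ, partialEuler d k (partialNormSq d k ^ n) =
      (2 * n : ℝ) • partialNormSq d k ^ n := by
    intro n
    induction n with
    | zero => simp
    | succ n ih =>
      rw [pow_succ', partialEuler_mul (partialEuler_partialNormSq hk) ih]
      push_cast
      ring_nf
  induction n with
  | zero => simp [poch_zero, hE.one]
  | succ n ih =>
    rw [pow_succ', hE.partialNormSq_mul hk (heul n), ih, poch_succ]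
    ring

/-- Green's formula: integrate the Euler operator by parts. The right side is symmetric in `p` and
`q`, which forces orthogonality of harmonic polynomials of different degrees. -/
theorem mul_partialLaplacian (hE : IsGaussian E) {k : ℕ} {p q : MvPolynomial (Fin d) ℝ} {m : ℝ}
    (hp : partialEuler d k p = m • p) (hlap : partialLaplacian d k p = 0) :
    m * E (q * p) = ∑ i ∈ range k, E (coordDeriv d i q * coordDeriv d i p) := by
  have h : ∀ i, E (coordVar d i * (q * coordDeriv d i p)) =
      E (q * coordDeriv d i (coordDeriv d i p)) + E (coordDeriv d i q * coordDeriv d i p) := by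
    intro i
    rw [hE.coordVar_mul, Derivation.leibniz, map_add, smul_eq_mul, smul_eq_mul,
      mul_comm (coordDeriv d i p)]
  have e : m * E (q * p) = E (q * partialEuler d k p) := by
    rw [hp, mul_smul_comm, map_smul, smul_eq_mul]
  have e2 : ∑ i ∈ range k, E (q * coordDeriv d i (coordDeriv d i p)) = 0 := by
    rw [← map_sum, ← Finset.mul_sum, ← partialLaplacian, hlap, mul_zero, map_zero]
  rw [e, partialEuler_apply, Finset.mul_sum, map_sum]
  simp only [mul_left_comm q, h, Finset.sum_add_distrib, e2, zero_add]

/-- Harmonic polynomials of different degrees are orthogonal. -/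
theorem mul_eq_zero_of_ne (hE : IsGaussian E) {k : ℕ} {p q : MvPolynomial (Fin d) ℝ} {m n : ℝ}
    (hp : partialEuler d k p = m • p) (hplap : partialLaplacian d k p = 0)
    (hq : partialEuler d k q = n • q) (hqlap : partialLaplacian d k q = 0) (hmn : m ≠ n) :
    E (p * q) = 0 := by
  have h1 := hE.mul_partialLaplacian (q := q) hp hplap
  have h2 := hE.mul_partialLaplacian (q := p) hq hqlap
  simp only [mul_comm (coordDeriv d _ q)] at h1
  rw [← h2, mul_comm q] at h1
  have : (m - n) * E (p * q) = 0 := by rw [sub_mul, h1, sub_self]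
  exact (mul_eq_zero.1 this).resolve_left (sub_ne_zero.2 hmn)

end IsGaussian

/-! ### Orthogonality with radial multipliers, and Gegenbauer norms -/

/-- The polynomials in `x_1² + ⋯ + x_k²` and the remaining variables `x_{k+1}, …, x_d`. -/
def radialSubalgebra (d k : ℕ) : Subalgebra ℝ (MvPolynomial (Fin d) ℝ) :=
  Algebra.adjoin ℝ (insert (partialNormSq d k) (coordVar d '' Set.Ici k))

theorem partialNormSq_mem_radialSubalgebra (k : ℕ) : partialNormSq d k ∈ radialSubalgebra d k :=
  Algebra.subset_adjoin (Set.mem_insert _ _)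

theorem coordVar_mem_radialSubalgebra {i k : ℕ} (hi : k ≤ i) :
    coordVar d i ∈ radialSubalgebra d k :=
  Algebra.subset_adjoin (Set.mem_insert_of_mem _ ⟨i, hi, rfl⟩)

theorem partialNormSq_succ_mem_radialSubalgebra (k : ℕ) :
    partialNormSq d (k + 1) ∈ radialSubalgebra d k := by
  rw [partialNormSq, Finset.sum_range_succ, ← partialNormSq]
  exact add_mem (partialNormSq_mem_radialSubalgebra k)
    (pow_mem (coordVar_mem_radialSubalgebra le_rfl) 2)

theorem radialSubalgebra_succ_le (k : ℕ) : radialSubalgebra d (k + 1) ≤ radialSubalgebra d k := by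
  refine Algebra.adjoin_le ?_
  rintro _ (rfl | ⟨i, hi, rfl⟩)
  · exact partialNormSq_succ_mem_radialSubalgebra k
  · exact coordVar_mem_radialSubalgebra (Nat.le_of_succ_le hi)

namespace IsGaussian

variable {E : MvPolynomial (Fin d) ℝ →ₗ[ℝ] ℝ}

/-- It suffices to test against `g` in the later variables. Multiplying by a generator preserves the
hypotheses: a later variable is absorbed into `g`, and `x_1² + ⋯ + x_k²` only multiplies the
expectation by `k` plus the Euler eigenvalue. -/
theorem mul_eq_zero_of_mem_radialSubalgebra (hE : IsGaussian E) {k : ℕ} (hk : k ≤ d)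
    {p : MvPolynomial (Fin d) ℝ} {m : ℝ} (hp : partialEuler d k p = m • p)
    (h0 : ∀ g, (∀ i < k, coordDeriv d i g = 0) → E (p * g) = 0)
    {f : MvPolynomial (Fin d) ℝ} (hf : f ∈ radialSubalgebra d k) : E (f * p) = 0 := by
  have key : ∀ f ∈ Submonoid.closure (insert (partialNormSq d k) (coordVar d '' Set.Ici k)),
      ∀ p, ((∃ m : ℝ, partialEuler d k p = m • p) ∧
        ∀ g, (∀ i < k, coordDeriv d i g = 0) → E (p * g) = 0) →
      ((∃ m : ℝ, partialEuler d k (f * p) = m • (f * p)) ∧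
        ∀ g, (∀ i < k, coordDeriv d i g = 0) → E (f * p * g) = 0) := by
    intro f hf
    induction hf using Submonoid.closure_induction with
    | one => simp
    | mul x y _ _ hx hy =>
      intro p hp
      rw [mul_assoc]
      exact hx _ (hy _ hp)
    | mem x hx =>
      rintro p ⟨⟨m, hm⟩, h0⟩
      rcases hx with rfl | ⟨i, hi, rfl⟩
      · refine ⟨⟨_, partialEuler_mul (partialEuler_partialNormSq hk) hm⟩, fun g hg => ?_⟩
        have hg' : partialEuler d k g = (0 : ℝ) • g := by rw [partialEuler_eq_zero hg, zero_smul]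
        rw [mul_assoc, hE.partialNormSq_mul hk (partialEuler_mul hm hg'), h0 g hg, mul_zero]
      · have hx : ∀ j < k, coordDeriv d j (coordVar d i) = 0 := fun j hj =>
          coordDeriv_coordVar_of_ne (by have : k ≤ i := hi; omega)
        have hx' : partialEuler d k (coordVar d i) = (0 : ℝ) • coordVar d i := by
          rw [partialEuler_eq_zero hx, zero_smul]
        refine ⟨⟨_, partialEuler_mul hx' hm⟩, fun g hg => ?_⟩
        rw [mul_comm (coordVar d i), mul_assoc]
        refine h0 _ fun j hj => ?_
        rw [Derivation.leibniz, hx j hj, hg j hj]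
        simp
  rw [radialSubalgebra, ← Subalgebra.mem_toSubmodule, Algebra.adjoin_eq_span] at hf
  induction hf using Submodule.span_induction with
  | mem x hx =>
    have := (key x hx p ⟨⟨m, hp⟩, h0⟩).2 1 (fun i _ => by simp)
    rwa [mul_one] at this
  | zero => simp
  | add x y _ _ hx hy => rw [add_mul, map_add, hx, hy, add_zero]
  | smul c x _ hx => rw [smul_mul_assoc, map_smul, hx, smul_zero]

/-- A factor `g` in the later variables is a constant for the first `k`, so `q * g` is still
harmonic of Euler degree `n` there and is orthogonal to `p`. -/
theorem harmonic_mul_eq_zero (hE : IsGaussian E) {k m n : ℕ} (hk : k ≤ d)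
    {p q f : MvPolynomial (Fin d) ℝ} (hp : IsHarmonicOfDegree k m p)
    (hq : IsHarmonicOfDegree k n q) (hmn : m ≠ n) (hf : f ∈ radialSubalgebra d k) :
    E (f * (p * q)) = 0 := by
  refine hE.mul_eq_zero_of_mem_radialSubalgebra hk (partialEuler_mul hp.euler hq.euler) ?_ hf
  intro g hg
  rw [mul_assoc]
  have hg' : partialEuler d k g = (0 : ℝ) • g := by rw [partialEuler_eq_zero hg, zero_smul]
  refine hE.mul_eq_zero_of_ne hp.euler hp.laplacian_eq_zero (partialEuler_mul hq.euler hg') ?_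
    (by simpa using hmn)
  rw [partialLaplacian_mul, hq.laplacian_eq_zero]
  have h1 : partialLaplacian d k g = 0 :=
    Finset.sum_eq_zero fun i hi => by rw [hg i (mem_range.1 hi), map_zero]
  have h2 : ∑ i ∈ range k, coordDeriv d i q * coordDeriv d i g = 0 :=
    Finset.sum_eq_zero fun i hi => by rw [hg i (mem_range.1 hi), mul_zero]
  rw [h1, h2]
  simp

/-- The Gaussian norm of the harmonic polynomials built from a Gegenbauer polynomial. -/
theorem homGegenbauer_mul_sq (hE : IsGaussian E) {k N : ℕ} (hk : k < d)
    {q : MvPolynomial (Fin d) ℝ} (hq : IsHarmonicOfDegree k N q) {μ : ℝ}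
    (hμ : μ = N + ((k : ℝ) - 1) / 2) (a : ℕ) :
    E ((homGegenbauer μ (partialNormSq d (k + 1)) (coordVar d k) a * q) ^ 2) =
      2 ^ a * poch μ a * poch (2 * μ) a / a.factorial * E (q ^ 2) := by
  have hH := fun a => hq.homGegenbauer_mul hk hμ a
  have hder := coordDeriv_homGegenbauer_mul hk (hq.coordDeriv_eq_zero k le_rfl) μ
  have hrec := homGegenbauer_mul_recurrence μ (partialNormSq d (k + 1)) (coordVar d k) q
  have h0 : homGegenbauer μ (partialNormSq d (k + 1)) (coordVar d k) 0 * q = q := by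
    rw [homGegenbauer_zero, one_mul]
  have h1 : homGegenbauer μ (partialNormSq d (k + 1)) (coordVar d k) 1 * q =
      (2 * μ) • (coordVar d k * q) := by
    rw [homGegenbauer_one, smul_mul_assoc]
  generalize hP : (fun a => homGegenbauer μ (partialNormSq d (k + 1)) (coordVar d k) a * q) = P
  simp only [funext_iff] at hP
  simp only [hP] at *
  -- Expand one factor of the square by the recurrence and integrate the axis variable by parts. The
  -- terms containing `E (P a * P (a + 2))` vanish by orthogonality. The first step is separate
  -- since the recurrence starts in degree two.
  have hstep : ∀ a, E (P (a + 1) ^ 2) =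
      2 * (μ + a) * (2 * μ + a) / (a + 1) * E (P a ^ 2) := by
    intro a
    cases a with
    | zero =>
      have e : P 1 ^ 2 = (2 * μ) • (coordVar d k * (q * P 1)) := by
        nth_rw 1 [pow_two, h1]
        rw [smul_mul_assoc, mul_assoc]
      have hd := hder 0
      rw [zero_add] at hd ⊢
      rw [e, map_smul, hE.coordVar_mul, Derivation.leibniz, hd,
        hq.coordDeriv_eq_zero k le_rfl, h0]
      simp [pow_two, mul_assoc]
    | succ a =>
      have e : P (a + 2) ^ 2 = ((a : ℝ) + 2)⁻¹ •
          ((2 * (a + 1 + μ)) • (coordVar d k * (P (a + 1) * P (a + 2))) -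
            (a + 2 * μ) • (partialNormSq d (k + 1) * (P a * P (a + 2)))) := by
        nth_rw 1 [pow_two, hrec]
        simp only [smul_mul_assoc, sub_mul, mul_assoc]
      have horth : E (P a * P (a + 2)) = 0 := by
        simpa using hE.harmonic_mul_eq_zero hk (hH a) (hH (a + 2)) (by omega) (one_mem _)
      have hdd := hder (a + 1)
      rw [e, map_smul, map_sub, map_smul, map_smul, hE.coordVar_mul,
        hE.partialNormSq_mul hk (partialEuler_mul (hH a).euler (hH (a + 2)).euler), horth,
        Derivation.leibniz, hdd, hder a]
      simp only [smul_eq_mul, mul_smul_comm, smul_mul_assoc, map_add, map_smul, mul_comm (P (a + 2)), horth,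
        pow_two]
      push_cast
      have : (a : ℝ) + 2 ≠ 0 := by positivity
      field_simp
      ring
  induction a with
  | zero => simp [poch_zero, h0]
  | succ a ih =>
    rw [hstep, ih, poch_succ, poch_succ, Nat.factorial_succ]
    push_cast
    have : (a : ℝ) + 1 ≠ 0 := by positivity
    have : (a.factorial : ℝ) ≠ 0 := by positivity
    field_simp
    ring

end IsGaussian

/-! ### Planar harmonics and the rotation field -/

/-- The real and imaginary parts of `(x_2 + i x_1) ^ m`. -/
def planarPair (d : ℕ) : ℕ → MvPolynomial (Fin d) ℝ × MvPolynomial (Fin d) ℝ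
  | 0 => (1, 0)
  | m + 1 => (coordVar d 1 * (planarPair d m).1 - coordVar d 0 * (planarPair d m).2,
      coordVar d 1 * (planarPair d m).2 + coordVar d 0 * (planarPair d m).1)

theorem planarPair_zero : planarPair d 0 = (1, 0) := by rw [planarPair]

theorem planarPair_succ (m : ℕ) : planarPair d (m + 1) =
    (coordVar d 1 * (planarPair d m).1 - coordVar d 0 * (planarPair d m).2,
      coordVar d 1 * (planarPair d m).2 + coordVar d 0 * (planarPair d m).1) := by rw [planarPair]

theorem coordDeriv_planarPair_of_le {i : ℕ} (hi : 2 ≤ i) (m : ℕ) :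
    coordDeriv d i (planarPair d m).1 = 0 ∧ coordDeriv d i (planarPair d m).2 = 0 := by
  have e0 : coordDeriv d i (coordVar d 0) = 0 := coordDeriv_coordVar_of_ne (by omega)
  have e1 : coordDeriv d i (coordVar d 1) = 0 := coordDeriv_coordVar_of_ne (by omega)
  induction m with
  | zero => simp [planarPair_zero]
  | succ m ih => simp [planarPair_succ, e0, e1, ih.1, ih.2]

/-- With `z = x_2 + i x_1`, these are the real and imaginary parts of `∂_{x_2} z^{m+1} = (m + 1)
z^m` and `∂_{x_1} z^{m+1} = i (m + 1) z^m`. -/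
theorem coordDeriv_planarPair (hd : 2 ≤ d) (m : ℕ) :
    coordDeriv d 0 (planarPair d (m + 1)).1 = -((m + 1 : ℝ) • (planarPair d m).2) ∧
    coordDeriv d 1 (planarPair d (m + 1)).1 = (m + 1 : ℝ) • (planarPair d m).1 ∧
    coordDeriv d 0 (planarPair d (m + 1)).2 = (m + 1 : ℝ) • (planarPair d m).1 ∧
    coordDeriv d 1 (planarPair d (m + 1)).2 = (m + 1 : ℝ) • (planarPair d m).2 := by
  have e00 : coordDeriv d 0 (coordVar d 0) = 1 := coordDeriv_coordVar_self (by omega)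
  have e11 : coordDeriv d 1 (coordVar d 1) = 1 := coordDeriv_coordVar_self (by omega)
  have e01 : coordDeriv d 0 (coordVar d 1) = 0 := coordDeriv_coordVar_of_ne (by omega)
  have e10 : coordDeriv d 1 (coordVar d 0) = 0 := coordDeriv_coordVar_of_ne (by omega)
  induction m with
  | zero => simp [planarPair_succ, planarPair_zero, e00, e01, e10, e11]
  | succ m ih =>
    obtain ⟨h1, h2, h3, h4⟩ := ih
    have c := congrArg Prod.fst (planarPair_succ (d := d) m)
    have s := congrArg Prod.snd (planarPair_succ (d := d) m)
    rw [planarPair_succ (m + 1)]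
    simp only [map_add, map_sub, Derivation.leibniz, h1, h2, h3, h4, e00, e01, e10, e11,
      smul_eq_mul, Nat.cast_add, Nat.cast_one, ← C_mul', map_one, map_natCast] at c s ⊢
    refine ⟨?_, ?_, ?_, ?_⟩
    · linear_combination ((m : MvPolynomial (Fin d) ℝ) + 1) * s
    · linear_combination (-(m : MvPolynomial (Fin d) ℝ) - 1) * c
    · linear_combination (-(m : MvPolynomial (Fin d) ℝ) - 1) * c
    · linear_combination (-(m : MvPolynomial (Fin d) ℝ) - 1) * s

theorem planarPair_sq_add_sq (m : ℕ) :
    (planarPair d m).1 ^ 2 + (planarPair d m).2 ^ 2 = partialNormSq d 2 ^ m := by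
  induction m with
  | zero => simp [planarPair_zero]
  | succ m ih =>
    have : partialNormSq d 2 = coordVar d 0 ^ 2 + coordVar d 1 ^ 2 := by
      simp [partialNormSq, Finset.sum_range_succ]
    rw [pow_succ (partialNormSq d 2), ← ih, planarPair_succ, this]
    ring

theorem planarPair_isHomogeneous (m : ℕ) :
    (planarPair d m).1.IsHomogeneous m ∧ (planarPair d m).2.IsHomogeneous m := by
  induction m with
  | zero => rw [planarPair_zero]; exact ⟨isHomogeneous_one _ _, isHomogeneous_zero _ _ _⟩
  | succ m ih =>
    rw [planarPair_succ, add_comm m]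
    exact ⟨((coordVar_isHomogeneous 1).mul ih.1).sub ((coordVar_isHomogeneous 0).mul ih.2),
      ((coordVar_isHomogeneous 1).mul ih.2).add ((coordVar_isHomogeneous 0).mul ih.1)⟩

theorem planarPair_isHarmonicOfDegree (hd : 2 ≤ d) (m : ℕ) :
    IsHarmonicOfDegree 2 m (planarPair d m).1 ∧ IsHarmonicOfDegree 2 m (planarPair d m).2 := by
  suffices H : (partialLaplacian d 2 (planarPair d m).1 = 0 ∧
      partialEuler d 2 (planarPair d m).1 = (m : ℝ) • (planarPair d m).1) ∧
      partialLaplacian d 2 (planarPair d m).2 = 0 ∧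
      partialEuler d 2 (planarPair d m).2 = (m : ℝ) • (planarPair d m).2 from
    ⟨⟨fun i hi => (coordDeriv_planarPair_of_le hi m).1, H.1.1, H.1.2,
        (planarPair_isHomogeneous m).1⟩,
      ⟨fun i hi => (coordDeriv_planarPair_of_le hi m).2, H.2.1, H.2.2,
        (planarPair_isHomogeneous m).2⟩⟩
  simp only [partialLaplacian, partialEuler_apply, Finset.sum_range_succ, Finset.sum_range_zero,
    zero_add]
  cases m with
  | zero => simp [planarPair_zero]
  | succ m =>
    obtain ⟨h1, h2, h3, h4⟩ := coordDeriv_planarPair hd m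
    rw [h1, h2, h3, h4]
    refine ⟨⟨?_, ?_⟩, ?_, ?_⟩
    · cases m with
      | zero => simp [planarPair_zero]
      | succ m =>
        obtain ⟨g1, g2, g3, g4⟩ := coordDeriv_planarPair hd m
        rw [map_neg, Derivation.map_smul, Derivation.map_smul, g2, g3, neg_add_cancel]
    · rw [planarPair_succ]
      simp only [← C_mul', map_add, map_one, map_natCast, Nat.cast_add, Nat.cast_one]
      ring
    · cases m with
      | zero => simp [planarPair_zero]
      | succ m =>
        obtain ⟨g1, g2, g3, g4⟩ := coordDeriv_planarPair hd m
        rw [Derivation.map_smul, Derivation.map_smul, g1, g4, smul_neg, neg_add_cancel]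
    · rw [planarPair_succ]
      simp only [← C_mul', map_add, map_one, map_natCast, Nat.cast_add, Nat.cast_one]
      ring

/-- The infinitesimal rotation in the plane of the first two variables. -/
def planarRotation (d : ℕ) : Derivation ℝ (MvPolynomial (Fin d) ℝ) (MvPolynomial (Fin d) ℝ) :=
  coordVar d 1 • coordDeriv d 0 - coordVar d 0 • coordDeriv d 1

theorem planarRotation_apply (p : MvPolynomial (Fin d) ℝ) :
    planarRotation d p = coordVar d 1 * coordDeriv d 0 p - coordVar d 0 * coordDeriv d 1 p := rfl

/-- The rotation field multiplies `z^m` by `i m`. -/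
theorem planarRotation_planarPair (hd : 2 ≤ d) (m : ℕ) :
    planarRotation d (planarPair d m).1 = -((m : ℝ) • (planarPair d m).2) ∧
      planarRotation d (planarPair d m).2 = (m : ℝ) • (planarPair d m).1 := by
  cases m with
  | zero => simp [planarPair_zero]
  | succ m =>
    obtain ⟨h1, h2, h3, h4⟩ := coordDeriv_planarPair hd m
    rw [planarRotation_apply, planarRotation_apply, h1, h2, h3, h4, planarPair_succ]
    simp only [← C_mul', map_add, map_one, map_natCast, Nat.cast_add, Nat.cast_one]
    constructor <;> ring

namespace IsGaussian

variable {E : MvPolynomial (Fin d) ℝ →ₗ[ℝ] ℝ}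

theorem planarRotation_eq_zero (hE : IsGaussian E) (p : MvPolynomial (Fin d) ℝ) :
    E (planarRotation d p) = 0 := by
  rw [planarRotation_apply, map_sub, hE.coordVar_mul, hE.coordVar_mul, coordDeriv_comm, sub_self]

/-- For `g` in the later variables, `Re(z^m) Im(z^m) g` is `-1/(2m)` times the rotation derivative
of `Re(z^m)² g`, and `E` kills such derivatives. -/
theorem planarPair_fst_mul_snd (hE : IsGaussian E) (hd : 2 ≤ d) {m : ℕ} (hm : m ≠ 0)
    {f : MvPolynomial (Fin d) ℝ} (hf : f ∈ radialSubalgebra d 2) :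
    E (f * ((planarPair d m).1 * (planarPair d m).2)) = 0 := by
  have hH := planarPair_isHarmonicOfDegree hd m
  obtain ⟨hc, hs⟩ := planarRotation_planarPair hd m
  refine hE.mul_eq_zero_of_mem_radialSubalgebra hd (partialEuler_mul hH.1.euler hH.2.euler) ?_ hf
  intro g hg
  have hg' : planarRotation d g = 0 := by
    rw [planarRotation_apply, hg 0 (by omega), hg 1 (by omega)]
    simp
  have h := hE.planarRotation_eq_zero ((planarPair d m).1 ^ 2 * g)
  rw [Derivation.leibniz, hg', smul_zero, zero_add, Derivation.leibniz_pow, hc] at h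
  have e : g • (2 • (planarPair d m).1 ^ (2 - 1) • -((m : ℝ) • (planarPair d m).2)) =
      (-(2 * m : ℝ)) • ((planarPair d m).1 * (planarPair d m).2 * g) := by
    simp only [← C_mul', map_mul, map_neg, map_natCast, map_ofNat, smul_eq_mul, nsmul_eq_mul]
    push_cast
    ring
  rw [e, map_smul, smul_eq_mul] at h
  refine (mul_eq_zero.1 h).resolve_left ?_
  have : (m : ℝ) ≠ 0 := Nat.cast_ne_zero.2 hm
  simpa using this

/-- The rotation derivative of `Re(z^m) Im(z^m)` is `m` times the difference of the squares, so both
squares have the same expectation, half that of `|z|^{2m}`. -/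
theorem planarPair_sq (hE : IsGaussian E) (hd : 2 ≤ d) {m : ℕ} (hm : m ≠ 0) :
    2 * E ((planarPair d m).1 ^ 2) = 2 ^ m * poch 1 m ∧
      2 * E ((planarPair d m).2 ^ 2) = 2 ^ m * poch 1 m := by
  obtain ⟨hc, hs⟩ := planarRotation_planarPair hd m
  have h := hE.planarRotation_eq_zero ((planarPair d m).1 * (planarPair d m).2)
  have e : planarRotation d ((planarPair d m).1 * (planarPair d m).2) =
      (m : ℝ) • ((planarPair d m).1 ^ 2 - (planarPair d m).2 ^ 2) := by
    rw [Derivation.leibniz, hc, hs]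
    simp only [← C_mul', smul_eq_mul]
    ring
  rw [e, map_smul, smul_eq_mul, map_sub] at h
  have h1 := (mul_eq_zero.1 h).resolve_left (Nat.cast_ne_zero.2 hm)
  have h2 := congrArg E (planarPair_sq_add_sq (d := d) m)
  rw [map_add, hE.partialNormSq_pow hd, Nat.cast_ofNat, div_self two_ne_zero] at h2
  constructor <;> linarith

end IsGaussian

/-! ### The Gaussian measure and the passage to the sphere -/

/-- The density of the standard Gaussian measure, up to normalization. -/
def gaussianWeight (d : ℕ) (x : EuclideanSpace ℝ (Fin d)) : ℝ := Real.exp (-‖x‖ ^ 2 / 2)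

theorem integrable_pow_mul_exp_neg_sq_half (n : ℕ) :
    Integrable fun x : ℝ => x ^ n * Real.exp (-x ^ 2 / 2) := by
  have h := integrable_rpow_mul_exp_neg_mul_sq (b := 1 / 2) (by norm_num) (s := n)
    (by linarith [n.cast_nonneg (α := ℝ)])
  refine h.congr (Filter.Eventually.of_forall fun x => ?_)
  simp only [Real.rpow_natCast]
  congr 2
  ring

theorem integrable_eval_mul_gaussianWeight (p : MvPolynomial (Fin d) ℝ) :
    Integrable fun x : EuclideanSpace ℝ (Fin d) => eval x.ofLp p * gaussianWeight d x := by
  induction p using MvPolynomial.induction_on' with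
  | add p q hp hq =>
    exact (hp.add hq).congr (Filter.Eventually.of_forall fun x => by simp [add_mul])
  | monomial e c =>
    rw [← (PiLp.volume_preserving_toLp (Fin d)).integrable_comp_emb
      (MeasurableEquiv.toLp 2 _).measurableEmbedding]
    have h := Integrable.fintype_prod (μ := fun _ => (volume : Measure ℝ))
      (f := fun (i : Fin d) x => x ^ e i * Real.exp (-x ^ 2 / 2))
      fun i => integrable_pow_mul_exp_neg_sq_half (e i)
    refine (h.const_mul c).congr (Filter.Eventually.of_forall fun x => ?_)
    simp only [Function.comp_apply, eval_monomial, gaussianWeight, Finset.prod_mul_distrib,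
      ← Real.exp_sum, EuclideanSpace.norm_sq_eq, Finsupp.prod_fintype _ _ fun i => pow_zero (x i),
      Real.norm_eq_abs, sq_abs, ← Finset.sum_div, Finset.sum_neg_distrib, mul_assoc]

theorem hasLineDerivAt_eval (p : MvPolynomial (Fin d) ℝ) (i : Fin d)
    (x : EuclideanSpace ℝ (Fin d)) :
    HasLineDerivAt ℝ (fun y : EuclideanSpace ℝ (Fin d) => eval y.ofLp p)
      (eval x.ofLp (pderiv i p)) x (EuclideanSpace.single i 1) := by
  unfold HasLineDerivAt
  induction p using MvPolynomial.induction_on with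
  | C a => simpa using hasDerivAt_const (0 : ℝ) a
  | add p q hp hq => simpa only [map_add] using hp.fun_add hq
  | mul_X p j hp =>
    have hX : HasDerivAt (fun t : ℝ => (x + t • EuclideanSpace.single i 1 :
        EuclideanSpace ℝ (Fin d)) j) (if j = i then 1 else 0) 0 := by
      have := ((hasDerivAt_id (0 : ℝ)).mul_const
        (if j = i then (1 : ℝ) else 0)).const_add (x j)
      simpa using this
    have h := hp.fun_mul hX
    simp only [map_mul, eval_X]
    refine h.congr_deriv ?_
    rw [zero_smul, add_zero, Derivation.leibniz, map_add, smul_eq_mul, smul_eq_mul, map_mul,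
      map_mul, eval_X, add_comm, mul_comm (x.ofLp j)]
    congr 2
    by_cases hij : j = i
    · subst hij; simp
    · simp [hij]

theorem hasLineDerivAt_gaussianWeight (i : Fin d) (x : EuclideanSpace ℝ (Fin d)) :
    HasLineDerivAt ℝ (gaussianWeight d) (-(x i * gaussianWeight d x)) x
      (EuclideanSpace.single i 1) := by
  have h : HasFDerivAt (fun y : EuclideanSpace ℝ (Fin d) => -‖y‖ ^ 2 / 2)
      (-(innerSL ℝ x)) x := by
    have := ((hasStrictFDerivAt_norm_sq x).hasFDerivAt.const_mul (-(1 / 2) : ℝ))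
    refine (this.congr_fderiv ?_).congr_of_eventuallyEq (Filter.Eventually.of_forall fun y => ?_)
    · ext y; simp
    · simp only; ring
  have h2 := h.exp.hasLineDerivAt (EuclideanSpace.single i 1)
  have e : (Real.exp (-‖x‖ ^ 2 / 2) • -(innerSL ℝ) x) (EuclideanSpace.single i 1) =
      -(x i * gaussianWeight d x) := by
    have : inner ℝ x (EuclideanSpace.single i 1) = x i := by
      rw [EuclideanSpace.inner_single_right]
      simp
    simp [gaussianWeight, mul_comm, this]
  rw [e] at h2
  exact h2

/-- Integration by parts, since `∂_i w = -x_i w` for the Gaussian weight `w`. -/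
theorem integral_coordVar_mul_gaussianWeight (i : Fin d) (p : MvPolynomial (Fin d) ℝ) :
    ∫ x : EuclideanSpace ℝ (Fin d), eval x.ofLp (X i * p) * gaussianWeight d x =
      ∫ x : EuclideanSpace ℝ (Fin d), eval x.ofLp (pderiv i p) * gaussianWeight d x := by
  have h := integral_bilinear_hasLineDerivAt_right_eq_neg_left_of_integrable
    (μ := (volume : Measure (EuclideanSpace ℝ (Fin d))))
    (f := fun x : EuclideanSpace ℝ (Fin d) => eval x.ofLp p)
    (f' := fun x : EuclideanSpace ℝ (Fin d) => eval x.ofLp (pderiv i p))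
    (g := gaussianWeight d) (g' := fun x => -(x i * gaussianWeight d x))
    (v := EuclideanSpace.single i 1) (B := ContinuousLinearMap.mul ℝ ℝ)
    (integrable_eval_mul_gaussianWeight _)
    (by
      refine (integrable_eval_mul_gaussianWeight (X i * p)).neg.congr
        (Filter.Eventually.of_forall fun x => ?_)
      simp only [Pi.neg_apply, map_mul, eval_X, ContinuousLinearMap.mul_apply']
      ring)
    (integrable_eval_mul_gaussianWeight _)
    (fun x _ => hasLineDerivAt_eval p i x) (fun x _ => hasLineDerivAt_gaussianWeight i x)
  simp only [ContinuousLinearMap.mul_apply'] at h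
  rw [← neg_inj, ← h, ← integral_neg]
  refine integral_congr_ae (Filter.Eventually.of_forall fun x => ?_)
  simp only [map_mul, eval_X]
  ring

theorem integral_gaussianWeight_pos :
    0 < ∫ x : EuclideanSpace ℝ (Fin d), gaussianWeight d x := by
  have h := integrable_eval_mul_gaussianWeight (1 : MvPolynomial (Fin d) ℝ)
  simp only [map_one, one_mul] at h
  refine (integral_pos_iff_support_of_nonneg (f := gaussianWeight d)
    (fun x => (Real.exp_pos _).le) h).2 ?_
  have : Function.support (gaussianWeight d) = Set.univ :=
    Set.eq_univ_of_forall fun x => (Real.exp_pos _).ne'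
  rw [this]
  exact Measure.measure_univ_pos.2 (NeZero.ne _)

/-- The expectation of a polynomial under the standard Gaussian measure. -/
def gaussianExpectation (d : ℕ) : MvPolynomial (Fin d) ℝ →ₗ[ℝ] ℝ where
  toFun p := (∫ x, gaussianWeight d x)⁻¹ *
    ∫ x : EuclideanSpace ℝ (Fin d), eval x.ofLp p * gaussianWeight d x
  map_add' p q := by
    simp only [map_add, add_mul]
    rw [integral_add (integrable_eval_mul_gaussianWeight p) (integrable_eval_mul_gaussianWeight q),
      mul_add]
  map_smul' c p := by
    simp only [smul_eval, mul_assoc, integral_const_mul, RingHom.id_apply, smul_eq_mul]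
    ring

theorem gaussianExpectation_apply (p : MvPolynomial (Fin d) ℝ) :
    gaussianExpectation d p = (∫ x, gaussianWeight d x)⁻¹ *
      ∫ x : EuclideanSpace ℝ (Fin d), eval x.ofLp p * gaussianWeight d x := rfl

theorem isGaussian_gaussianExpectation : IsGaussian (gaussianExpectation d) where
  one := by
    simp only [gaussianExpectation_apply, map_one, one_mul]
    exact inv_mul_cancel₀ integral_gaussianWeight_pos.ne'
  coordVar_mul i p := by
    unfold coordVar coordDeriv
    split_ifs with h
    · rw [gaussianExpectation_apply, gaussianExpectation_apply,
        integral_coordVar_mul_gaussianWeight]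
    · simp

theorem eval_smul_of_isHomogeneous {p : MvPolynomial (Fin d) ℝ} {m : ℕ} (hp : p.IsHomogeneous m)
    (c : ℝ) (x : Fin d → ℝ) : eval (c • x) p = c ^ m * eval x p := by
  rw [eval_eq', eval_eq', Finset.mul_sum]
  refine Finset.sum_congr rfl fun e he => ?_
  have hm : ∑ i, e i = m := by
    rw [← hp (mem_support_iff.1 he), Finsupp.weight_apply, Finsupp.sum_fintype _ _ (by simp)]
    simp
  simp only [Pi.smul_apply, smul_eq_mul, mul_pow, Finset.prod_mul_distrib,
    Finset.prod_pow_eq_pow_sum, hm]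
  ring

/-- Integration of a homogeneous polynomial against the Gaussian in polar coordinates. -/
theorem integral_eval_mul_gaussianWeight_eq (hd : 0 < d) {p : MvPolynomial (Fin d) ℝ}
    {m : ℕ} (hp : p.IsHomogeneous m) :
    ∫ x : EuclideanSpace ℝ (Fin d), eval x.ofLp p * gaussianWeight d x =
      (∫ x : Metric.sphere (0 : EuclideanSpace ℝ (Fin d)) 1,
        eval (x : EuclideanSpace ℝ (Fin d)).ofLp p ∂surfaceMeasure d) *
      ∫ r : Set.Ioi (0 : ℝ), (r : ℝ) ^ m * Real.exp (-(r : ℝ) ^ 2 / 2)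
        ∂Measure.volumeIoiPow (Module.finrank ℝ (EuclideanSpace ℝ (Fin d)) - 1) := by
  have h1 := integral_subtype_comap (μ := volume)
    (measurableSet_singleton (0 : EuclideanSpace ℝ (Fin d))).compl
    fun x => eval x.ofLp p * gaussianWeight d x
  have : Nonempty (Fin d) := ⟨⟨0, hd⟩⟩
  rw [restrict_compl_singleton] at h1
  rw [← h1, surfaceMeasure, ← integral_prod_mul,
    ← (volume : Measure (EuclideanSpace ℝ (Fin d))).measurePreserving_homeomorphUnitSphereProd.integral_comp
      (Homeomorph.measurableEmbedding _)]
  refine integral_congr_ae (Filter.Eventually.of_forall fun x => ?_)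
  have hx : ‖(x : EuclideanSpace ℝ (Fin d))‖ ≠ 0 := norm_ne_zero_iff.2 x.2
  simp only [homeomorphUnitSphereProd_apply_fst_coe, homeomorphUnitSphereProd_apply_snd_coe,
    WithLp.ofLp_smul, gaussianWeight]
  rw [eval_smul_of_isHomogeneous hp, inv_pow]
  field_simp

/-- Both `p q` and `|x|^{2n}` are homogeneous of degree `2n`, so their Gaussian integrals share the
same radial factor, which cancels; and `|x|^{2n} = 1` on the sphere produces `ω_d`. -/
theorem sphereInner_eq (hd : 0 < d) {n : ℕ} {p q : MvPolynomial (Fin d) ℝ}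
    (hp : p.IsHomogeneous n) (hq : q.IsHomogeneous n) :
    sphereInner d p q =
      gaussianExpectation d (p * q) / gaussianExpectation d (partialNormSq d d ^ n) := by
  have hR : (partialNormSq d d ^ n).IsHomogeneous (2 * n) := (partialNormSq_isHomogeneous d).pow n
  have hpq : (p * q).IsHomogeneous (2 * n) := two_mul n ▸ hp.mul hq
  have hRS : ∫ x : Metric.sphere (0 : EuclideanSpace ℝ (Fin d)) 1,
      eval (x : EuclideanSpace ℝ (Fin d)).ofLp (partialNormSq d d ^ n) ∂surfaceMeasure d =
      (surfaceMeasure d).real Set.univ := by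
    have : ∀ x : Metric.sphere (0 : EuclideanSpace ℝ (Fin d)) 1,
        eval (x : EuclideanSpace ℝ (Fin d)).ofLp (partialNormSq d d ^ n) = 1 := by
      intro x
      have hx : ‖(x : EuclideanSpace ℝ (Fin d))‖ ^ 2 = 1 := by simp
      rw [EuclideanSpace.norm_sq_eq] at hx
      simp only [Real.norm_eq_abs, sq_abs] at hx
      rw [map_pow, partialNormSq, map_sum, Finset.sum_range]
      simp [coordVar, hx]
    simp [this]
  have hpos : 0 < gaussianExpectation d (partialNormSq d d ^ n) := by
    rw [isGaussian_gaussianExpectation.partialNormSq_pow le_rfl]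
    have := poch_pos (a := (d : ℝ) / 2) (by positivity) n
    positivity
  rw [gaussianExpectation_apply, integral_eval_mul_gaussianWeight_eq hd hR, hRS] at hpos
  rw [gaussianExpectation_apply, gaussianExpectation_apply,
    integral_eval_mul_gaussianWeight_eq hd hR, integral_eval_mul_gaussianWeight_eq hd hpq, hRS,
    sphereInner]
  simp only [map_mul]
  have hZ := (inv_pos.2 (integral_gaussianWeight_pos (d := d))).ne'
  have h1 := right_ne_zero_of_mul hpos.ne'
  have h2 := left_ne_zero_of_mul h1
  have h3 := right_ne_zero_of_mul h1
  rw [mul_div_mul_left _ _ hZ, mul_div_mul_right _ _ h3, div_eq_inv_mul]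

/-! ### The hypergeometric Gegenbauer formula satisfies the recurrence -/

theorem homGegenbauer_mul_sq_mul (μ c x : ℝ) (a : ℕ) :
    homGegenbauer μ (c ^ 2) (c * x) a = c ^ a * homGegenbauer μ 1 x a := by
  induction a using Nat.twoStepInduction with
  | zero => simp [homGegenbauer_zero]
  | one => simp only [homGegenbauer_one, smul_eq_mul]; ring
  | more a h0 h1 =>
    simp only [homGegenbauer_succ_succ, h0, h1, smul_eq_mul]
    ring

/-- Four times the product of the `i`-th factors is `(a - 2i)(a - 2i - 1)`. -/
theorem poch_mul_poch_half (a j : ℕ) (hj : 2 * j ≤ a) :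
    poch (-(a : ℝ) / 2) j * poch ((1 - (a : ℝ)) / 2) j * 4 ^ j * (a - 2 * j).factorial =
      a.factorial := by
  induction j with
  | zero => simp [poch_zero]
  | succ j ih =>
    rw [← ih (by omega)]
    obtain ⟨m, rfl⟩ := Nat.exists_eq_add_of_le hj
    rw [show 2 * (j + 1) + m - 2 * j = m + 2 by omega,
      show 2 * (j + 1) + m - 2 * (j + 1) = m by omega, poch_succ, poch_succ,
      Nat.factorial_succ, Nat.factorial_succ]
    push_cast
    ring

/-- Up to sign, the factors of `(1 - a - μ)_j` are the last `j` factors of `(μ)_a`. -/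
theorem poch_one_sub_mul_poch (μ : ℝ) (a j : ℕ) (hj : j ≤ a) :
    poch (1 - (a : ℝ) - μ) j * (-1) ^ j * poch μ (a - j) = poch μ a := by
  induction j with
  | zero => simp [poch_zero]
  | succ j ih =>
    rw [← ih (by omega)]
    obtain ⟨m, rfl⟩ := Nat.exists_eq_add_of_le hj
    rw [show j + 1 + m - j = m + 1 by omega, show j + 1 + m - (j + 1) = m by omega, poch_succ,
      poch_succ]
    push_cast
    ring

/-- The coefficient of `t ^ (a - 2 j)` in the Gegenbauer polynomial of degree `a`. -/
def gegenbauerCoeff (μ : ℝ) (a j : ℕ) : ℝ :=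
  if 2 * j ≤ a then
    (-1) ^ j * poch μ (a - j) * 2 ^ (a - 2 * j) / (j.factorial * (a - 2 * j).factorial)
  else 0

/-- Coefficients with `2j > a` are zero, so the range may be enlarged; this aligns the three sums of
the recurrence. Positivity of `μ` keeps the hypergeometric denominators nonzero. -/
theorem gegenbauer_eq_sum_gegenbauerCoeff {μ : ℝ} (hμ : 0 < μ) (x : ℝ) {a M : ℕ}
    (hM : a / 2 + 1 ≤ M) :
    gegenbauer a μ x = ∑ j ∈ range M, gegenbauerCoeff μ a j * x ^ (a - 2 * j) := by
  rw [← Finset.sum_subset (Finset.range_subset_range.2 hM)]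
  · rw [gegenbauer, Finset.mul_sum]
    refine Finset.sum_congr rfl fun j hj => ?_
    have hj : 2 * j ≤ a := by have := mem_range.1 hj; omega
    have h1 := poch_mul_poch_half a j hj
    have h2 := poch_one_sub_mul_poch μ a j (by omega)
    have hne := (poch_pos hμ a).ne'
    have h3 : poch (1 - (a : ℝ) - μ) j ≠ 0 := by
      rintro h
      rw [h] at h2
      simp [hne.symm] at h2
    have h4 : (2 : ℝ) ^ a = 2 ^ (a - 2 * j) * 4 ^ j := by
      rw [show (4 : ℝ) = 2 ^ 2 by norm_num, ← pow_mul, ← pow_add]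
      congr 1
      omega
    rw [gegenbauerCoeff, if_pos hj, ← h2, h4, ← h1, ← mul_assoc]
    have h5 : ((a - 2 * j).factorial : ℝ) ≠ 0 := by positivity
    have h6 : (j.factorial : ℝ) ≠ 0 := by positivity
    have h7 : poch (-(a : ℝ) / 2) j * poch ((1 - (a : ℝ)) / 2) j ≠ 0 := by
      intro h
      rw [h] at h1
      simp only [zero_mul] at h1
      exact absurd h1.symm (by positivity)
    have h8 := left_ne_zero_of_mul h7
    have h9 := right_ne_zero_of_mul h7
    generalize poch (-(a : ℝ) / 2) j = u at *
    generalize poch ((1 - (a : ℝ)) / 2) j = v at *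
    field_simp
  · intro j _ hj
    rw [gegenbauerCoeff, if_neg, zero_mul]
    have := mt mem_range.2 hj
    omega

theorem gegenbauerCoeff_recurrence_zero (μ : ℝ) (a : ℕ) :
    ((a : ℝ) + 2) * gegenbauerCoeff μ (a + 2) 0 =
      2 * (a + 1 + μ) * gegenbauerCoeff μ (a + 1) 0 := by
  simp only [gegenbauerCoeff, mul_zero, Nat.zero_le, if_true, tsub_zero, pow_zero,
    poch_succ μ (a + 1), Nat.factorial_succ (a + 1)]
  push_cast
  have : (a : ℝ) + 1 + 1 ≠ 0 := by positivity
  field_simp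
  ring

theorem gegenbauerCoeff_recurrence_succ (μ : ℝ) (a j : ℕ) :
    ((a : ℝ) + 2) * gegenbauerCoeff μ (a + 2) (j + 1) =
      2 * (a + 1 + μ) * gegenbauerCoeff μ (a + 1) (j + 1) -
        (a + 2 * μ) * gegenbauerCoeff μ a j := by
  rcases le_or_gt (2 * j) a with h | h
  · obtain ⟨m, rfl⟩ := Nat.exists_eq_add_of_le h
    have hj : (j : ℝ) + 1 ≠ 0 := by positivity
    rw [gegenbauerCoeff, gegenbauerCoeff, gegenbauerCoeff, if_pos (by omega), if_pos h,
      show 2 * j + m + 2 - (j + 1) = m + j + 1 by omega,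
      show 2 * j + m + 2 - 2 * (j + 1) = m by omega, show 2 * j + m - j = m + j by omega,
      show 2 * j + m - 2 * j = m by omega, poch_succ, Nat.factorial_succ j]
    -- For `a = 2j`, the polynomial of degree `a + 1` has no coefficient of index `j + 1`.
    cases m with
    | zero =>
      rw [if_neg (by omega)]
      push_cast
      field_simp
      ring
    | succ m =>
      rw [if_pos (by omega), show 2 * j + (m + 1) + 1 - (j + 1) = m + 1 + j by omega,
        show 2 * j + (m + 1) + 1 - 2 * (j + 1) = m by omega, Nat.factorial_succ m]
      have hm : (m : ℝ) + 1 ≠ 0 := by positivity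
      push_cast
      field_simp
      ring
  · rw [gegenbauerCoeff, gegenbauerCoeff, gegenbauerCoeff, if_neg (by omega), if_neg (by omega),
      if_neg (by omega)]
    ring

theorem gegenbauer_recurrence {μ : ℝ} (hμ : 0 < μ) (x : ℝ) (a : ℕ) :
    ((a : ℝ) + 2) * gegenbauer (a + 2) μ x =
      2 * (a + 1 + μ) * (x * gegenbauer (a + 1) μ x) - (a + 2 * μ) * gegenbauer a μ x := by
  -- Where the truncated subtraction in the exponents would break the identity, the coefficient
  -- vanishes.
  have hx : ∀ j, gegenbauerCoeff μ (a + 1) j * x ^ (a + 2 - 2 * j) =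
      x * (gegenbauerCoeff μ (a + 1) j * x ^ (a + 1 - 2 * j)) := by
    intro j
    by_cases hj : 2 * j ≤ a + 1
    · rw [show a + 2 - 2 * j = a + 1 - 2 * j + 1 by omega, pow_succ]
      ring
    · simp [gegenbauerCoeff, hj]
  rw [gegenbauer_eq_sum_gegenbauerCoeff hμ x (show (a + 2) / 2 + 1 ≤ a + 2 + 1 by omega),
    gegenbauer_eq_sum_gegenbauerCoeff hμ x (show (a + 1) / 2 + 1 ≤ a + 2 + 1 by omega),
    gegenbauer_eq_sum_gegenbauerCoeff hμ x (show a / 2 + 1 ≤ a + 2 by omega), Finset.mul_sum _ _ x]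
  simp only [← hx]
  rw [Finset.sum_range_succ' (fun j => gegenbauerCoeff μ (a + 2) j * x ^ (a + 2 - 2 * j)),
    Finset.sum_range_succ' (fun j => gegenbauerCoeff μ (a + 1) j * x ^ (a + 2 - 2 * j)),
    mul_add, mul_add, ← mul_assoc, ← mul_assoc,
    gegenbauerCoeff_recurrence_zero, Finset.mul_sum, Finset.mul_sum, Finset.mul_sum,
    add_sub_right_comm, ← Finset.sum_sub_distrib]
  congr 1
  refine Finset.sum_congr rfl fun j _ => ?_
  rw [← mul_assoc, gegenbauerCoeff_recurrence_succ, show a + 2 - 2 * (j + 1) = a - 2 * j by omega]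
  ring

theorem homGegenbauer_eq_gegenbauer {μ : ℝ} (hμ : 0 < μ) (x : ℝ) (a : ℕ) :
    homGegenbauer μ 1 x a = gegenbauer a μ x := by
  induction a using Nat.twoStepInduction with
  | zero => simp [homGegenbauer_zero, gegenbauer, poch_zero]
  | one => simp [homGegenbauer_one, gegenbauer, poch_zero, poch_succ, mul_comm]
  | more a h0 h1 =>
    have ha : (a : ℝ) + 2 ≠ 0 := by positivity
    apply mul_left_cancel₀ ha
    rw [gegenbauer_recurrence hμ, ← h0, ← h1]
    simpa using homGegenbauer_recurrence μ 1 x a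

/-! ### The dimension bound -/

/-- A harmonic polynomial is determined by its coefficients at the monomials whose exponent at a
given variable is at most one. -/
theorem eq_zero_of_laplacian_eq_zero (i : Fin d) {p : MvPolynomial (Fin d) ℝ}
    (hp : laplacian d p = 0) (h0 : ∀ e : Fin d →₀ ℕ, e i ≤ 1 → coeff e p = 0) : p = 0 := by
  have key : ∀ (k : ℕ) (e : Fin d →₀ ℕ), e i = k → coeff e p = 0 := by
    intro k
    induction k using Nat.strong_induction_on with
    | _ k ih =>
      intro e he
      by_cases hk : k ≤ 1
      · exact h0 e (he ▸ hk)
      -- The coefficient of the Laplacian at `f` expresses the coefficient at `f + 2 e_i` through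
      -- those at `f + 2 e_j` with `j ≠ i`, whose exponent at `i` is smaller by two.
      obtain ⟨f, rfl⟩ : ∃ f : Fin d →₀ ℕ, e = f + Finsupp.single i 1 + Finsupp.single i 1 := by
        refine ⟨e - Finsupp.single i 2, ?_⟩
        rw [add_assoc, ← Finsupp.single_add, tsub_add_cancel_of_le]
        rw [Finsupp.single_le_iff]
        omega
      have hl := congrArg (coeff f) hp
      simp only [laplacian, LinearMap.sum_apply, LinearMap.comp_apply, coeff_sum,
        Derivation.coeFn_coe, coeff_pderiv, coeff_zero] at hl
      rw [Finset.sum_eq_single i] at hl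
      · have h1 : (((f + Finsupp.single i 1 : Fin d →₀ ℕ) i : ℝ) + 1) ≠ 0 := by positivity
        have h2 : ((f i : ℝ) + 1) ≠ 0 := by positivity
        exact (mul_eq_zero.1 ((mul_eq_zero.1 hl).resolve_right h2)).resolve_right h1
      · intro j _ hj
        rw [ih (f i) (by simp at he; omega) _ (by simp [hj])]
        simp
      · simp
  ext e
  exact key _ e rfl

theorem entry_add_one {M : Type*} [Zero M] {k : ℕ} (v : Fin k → M) (i : Fin k) :
    entry v ((i : ℕ) + 1) = v i := by
  rw [entry, dif_pos ⟨by omega, i.2⟩]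
  rfl

theorem tailSum_eq_add {α : Fin d → ℕ} {j : ℕ} (hj : j ≤ d - 1) :
    tailSum α j = entry α j + tailSum α (j + 1) := by
  rw [tailSum, tailSum, ← Finset.insert_Icc_add_one_left_eq_Icc hj, Finset.sum_insert (by simp)]

theorem tailSum_eq_zero {α : Fin d → ℕ} {j : ℕ} (hj : d - 1 < j) : tailSum α j = 0 := by
  rw [tailSum, Finset.Icc_eq_empty (by omega), Finset.sum_empty]

theorem ext_of_entry {α β : Fin d → ℕ} (h : ∀ j, 1 ≤ j → j ≤ d → entry α j = entry β j) :
    α = β := by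
  funext i
  rw [← entry_add_one α, ← entry_add_one β]
  exact h _ (by omega) (by omega)

theorem sum_eq_tailSum_add (hd : 0 < d) (α : Fin d → ℕ) :
    ∑ i, α i = tailSum α 1 + entry α d := by
  obtain ⟨k, rfl⟩ := Nat.exists_eq_succ_of_ne_zero hd.ne'
  have h : ∑ i, α i = ∑ i ∈ range (k + 1), entry α (i + 1) := by
    rw [Finset.sum_range]
    exact Finset.sum_congr rfl fun i _ => (entry_add_one α i).symm
  have h2 : tailSum α 1 = ∑ i ∈ range k, entry α (i + 1) := by
    rw [tailSum, Nat.succ_sub_one, ← Finset.Ico_add_one_right_eq_Icc, Finset.sum_Ico_eq_sum_range]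
    simp [add_comm]
  rw [h, Finset.sum_range_succ, h2]

instance finite_index (d n : ℕ) : Finite (Index d n) := by
  rcases Nat.eq_zero_or_pos d with rfl | hd
  · unfold Index
    infer_instance
  · have : ((Set.Iic fun _ => n + 1 : Set (Fin d → ℕ))).Finite := Set.finite_Iic _
    refine Set.Finite.subset this ?_
    rintro α ⟨h1, h2⟩ i
    have := Finset.single_le_sum (f := α) (fun _ _ => Nat.zero_le _) (Finset.mem_univ i)
    rw [sum_eq_tailSum_add hd, h1] at this
    have : entry α d ≤ 1 := by rcases h2 with h | ⟨h, -⟩ <;> omega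
    simp only
    omega

/-- The exponent of the monomial attached to an index. -/
def indexExponent {n : ℕ} (α : Index d n) : Fin d →₀ ℕ :=
  Finsupp.equivFunOnFinite.symm fun i =>
    if (i : ℕ) + 2 = d then entry α.1 (d - 1) - entry α.1 d else α.1 i

/-- Take `α_d = e_d` and `α_{d-1} = e_{d-1} + e_d`, leaving the other entries alone. Then `α_d = 1`
forces `α_{d-1} ≥ 1`, as an index requires. -/
theorem exists_indexExponent_eq (hd : 2 ≤ d) {n : ℕ} {e : Fin d →₀ ℕ} (he : ∑ i, e i = n)
    (hlast : e ⟨d - 1, by omega⟩ ≤ 1) : ∃ α : Index d n, indexExponent α = e := by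
  set l : Fin d := ⟨d - 1, by omega⟩ with hl
  set m : Fin d := ⟨d - 2, by omega⟩ with hm
  have hml : l ≠ m := by simp only [hl, hm, ne_eq, Fin.mk.injEq]; omega
  let α : Fin d → ℕ := Function.update e m (e m + e l)
  have hαl : entry α d = e l := by
    have := entry_add_one α l
    rw [show (l : ℕ) + 1 = d by simp only [hl]; omega] at this
    rw [this]
    exact Function.update_of_ne hml _ _
  have hαm : entry α (d - 1) = e m + e l := by
    have := entry_add_one α m
    rw [show (m : ℕ) + 1 = d - 1 by simp only [hm]; omega] at this
    rw [this]
    exact Function.update_self _ _ _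
  have hsum : ∑ i, α i = n + e l := by
    have h1 := Finset.sum_update_of_mem (Finset.mem_univ m) (fun i => e i) (e m + e l)
    have h2 := Finset.add_sum_erase Finset.univ (fun i => e i) (Finset.mem_univ m)
    rw [Finset.erase_eq] at h2
    have h3 : ∑ i, α i = e m + e l + ∑ i ∈ univ \ {m}, e i := h1
    omega
  rw [sum_eq_tailSum_add (by omega), hαl] at hsum
  refine ⟨⟨α, by omega, ?_⟩, ?_⟩
  · rw [hαl, hαm]
    omega
  · ext i
    change (if (i : ℕ) + 2 = d then entry α (d - 1) - entry α d else α i) = e i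
    split_ifs with hi
    · have : i = m := Fin.ext (by simp only [hm]; omega)
      rw [hαl, hαm, this]
      omega
    · refine Function.update_of_ne ?_ _ _
      rintro rfl
      simp only [hm] at hi
      omega

/-- The coefficients of a harmonic polynomial that determine it. -/
def indexCoeff (d n : ℕ) : harmonicSubmodule d n →ₗ[ℝ] Index d n → ℝ :=
  LinearMap.pi fun α => lcoeff ℝ (indexExponent α) ∘ₗ (harmonicSubmodule d n).subtype

theorem indexCoeff_injective (hd : 2 ≤ d) (n : ℕ) : Function.Injective (indexCoeff d n) := by
  rw [injective_iff_map_eq_zero]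
  rintro ⟨p, hp⟩ h
  ext1
  obtain ⟨hhom, hlap⟩ := Submodule.mem_inf.1 hp
  refine eq_zero_of_laplacian_eq_zero ⟨d - 1, by omega⟩ hlap fun e he => ?_
  by_cases hn : ∑ i, e i = n
  · obtain ⟨α, rfl⟩ := exists_indexExponent_eq hd hn he
    exact congrFun h α
  · refine IsHomogeneous.coeff_eq_zero ((mem_homogeneousSubmodule _ _).1 hhom) ?_
    rwa [Finsupp.degree_eq_sum]

/-! ### The product polynomials: harmonicity, orthogonality and norms -/

/-- The polynomial in the first `l + 2` variables from which `Y_α` is built, without its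
normalizing constant. -/
def harmonicFactor (α : Fin d → ℕ) : ℕ → MvPolynomial (Fin d) ℝ
  | 0 => if entry α d = 0 then (planarPair d (entry α (d - 1))).1
      else (planarPair d (entry α (d - 1))).2
  | l + 1 => homGegenbauer (lam α (d - 2 - l)) (partialNormSq d (l + 3)) (coordVar d (l + 2))
      (entry α (d - 2 - l)) * harmonicFactor α l

theorem harmonicFactor_zero (α : Fin d → ℕ) : harmonicFactor α 0 =
    if entry α d = 0 then (planarPair d (entry α (d - 1))).1
      else (planarPair d (entry α (d - 1))).2 := by rw [harmonicFactor]

theorem harmonicFactor_succ (α : Fin d → ℕ) (l : ℕ) : harmonicFactor α (l + 1) =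
    homGegenbauer (lam α (d - 2 - l)) (partialNormSq d (l + 3)) (coordVar d (l + 2))
      (entry α (d - 2 - l)) * harmonicFactor α l := by rw [harmonicFactor]

theorem tailSum_sub_one (α : Fin d → ℕ) : tailSum α (d - 1) = entry α (d - 1) := by
  rw [tailSum, Finset.Icc_self, Finset.sum_singleton]

theorem tailSum_sub_add_two {α : Fin d → ℕ} {l : ℕ} (hl : l + 3 ≤ d) :
    tailSum α (d - 1 - (l + 1)) = entry α (d - 2 - l) + tailSum α (d - 1 - l) := by
  rw [show d - 1 - (l + 1) = d - 2 - l by omega, tailSum_eq_add (by omega),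
    show d - 2 - l + 1 = d - 1 - l by omega]

/-- This is the parameter `N + (k - 1)/2` that harmonicity demands, with `k = l + 2` variables and
`N` the degree reached so far. -/
theorem lam_eq {α : Fin d → ℕ} {l : ℕ} (hl : l + 3 ≤ d) :
    lam α (d - 2 - l) = (tailSum α (d - 1 - l) : ℝ) + (((l + 2 : ℕ) : ℝ) - 1) / 2 := by
  rw [lam, show d - 2 - l + 1 = d - 1 - l by omega, show d - 2 - l = d - (l + 2) by omega,
    Nat.cast_sub (by omega)]
  ring

theorem lam_pos {α : Fin d → ℕ} {l : ℕ} (hl : l + 3 ≤ d) : 0 < lam α (d - 2 - l) := by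
  rw [lam_eq hl]
  push_cast
  have : (0 : ℝ) ≤ l := Nat.cast_nonneg l
  have : (0 : ℝ) ≤ tailSum α (d - 1 - l) := Nat.cast_nonneg _
  linarith

theorem harmonicFactor_isHarmonicOfDegree (α : Fin d → ℕ) {l : ℕ} (hl : l + 2 ≤ d) :
    IsHarmonicOfDegree (l + 2) (tailSum α (d - 1 - l)) (harmonicFactor α l) := by
  induction l with
  | zero =>
    have h := planarPair_isHarmonicOfDegree hl (entry α (d - 1))
    rw [harmonicFactor_zero, tsub_zero, tailSum_sub_one]
    split_ifs
    · exact h.1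
    · exact h.2
  | succ l ih =>
    rw [harmonicFactor_succ, tailSum_sub_add_two (by omega)]
    exact (ih (by omega)).homGegenbauer_mul (by omega) (lam_eq (by omega)) _

/-- The Gegenbauer factors added at higher levels are radial for the lower level, so they are
absorbed into the multiplier `f`. -/
theorem IsGaussian.harmonicFactor_mul_lift {E : MvPolynomial (Fin d) ℝ →ₗ[ℝ] ℝ}
    {α β : Fin d → ℕ} {l : ℕ}
    (h : ∀ f ∈ radialSubalgebra d (l + 2), E (f * (harmonicFactor α l * harmonicFactor β l)) = 0)
    {l' : ℕ} (hl : l ≤ l') :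
    ∀ f ∈ radialSubalgebra d (l' + 2),
      E (f * (harmonicFactor α l' * harmonicFactor β l')) = 0 := by
  induction l', hl using Nat.le_induction with
  | base => exact h
  | succ k _ ih =>
    intro f hf
    have hG : ∀ μ a, homGegenbauer μ (partialNormSq d (k + 3)) (coordVar d (k + 2)) a ∈
        radialSubalgebra d (k + 2) := fun μ a =>
      homGegenbauer_mem_subalgebra _ _ _ _ (partialNormSq_succ_mem_radialSubalgebra _)
        (coordVar_mem_radialSubalgebra le_rfl) _
    rw [harmonicFactor_succ, harmonicFactor_succ, mul_mul_mul_comm, ← mul_assoc]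
    exact ih _ (mul_mem (radialSubalgebra_succ_le _ hf) (mul_mem (hG _ _) (hG _ _)))

/-- If the degrees differ at some level, orthogonality holds there and lifts. Otherwise the indices
differ only in the last label, and the planar factors are a cosine and a sine of the same frequency,
which is positive by the sine condition. -/
theorem IsGaussian.harmonicFactor_mul_eq_zero {E : MvPolynomial (Fin d) ℝ →ₗ[ℝ] ℝ}
    (hE : IsGaussian E) (hd : 2 ≤ d) {n : ℕ} {α β : Index d n} (hαβ : α ≠ β) :
    E (harmonicFactor α.1 (d - 2) * harmonicFactor β.1 (d - 2)) = 0 := by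
  obtain ⟨l, hl, h⟩ : ∃ l ≤ d - 2, ∀ f ∈ radialSubalgebra d (l + 2),
      E (f * (harmonicFactor α.1 l * harmonicFactor β.1 l)) = 0 := by
    by_cases ht : ∃ l ≤ d - 2, tailSum α.1 (d - 1 - l) ≠ tailSum β.1 (d - 1 - l)
    · obtain ⟨l, hl, hne⟩ := ht
      exact ⟨l, hl, fun f hf => hE.harmonic_mul_eq_zero (by omega)
        (harmonicFactor_isHarmonicOfDegree α.1 (by omega))
        (harmonicFactor_isHarmonicOfDegree β.1 (by omega)) hne hf⟩
    push Not at ht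
    have ht' : ∀ j, 1 ≤ j → tailSum α.1 j = tailSum β.1 j := by
      intro j hj
      by_cases hjd : j ≤ d - 1
      · have := ht (d - 1 - j) (by omega)
        rwa [show d - 1 - (d - 1 - j) = j by omega] at this
      · rw [tailSum_eq_zero (by omega), tailSum_eq_zero (by omega)]
    have hent : ∀ j, 1 ≤ j → j ≤ d - 1 → entry α.1 j = entry β.1 j := by
      intro j hj hjd
      have h1 := ht' j hj
      rw [tailSum_eq_add hjd, tailSum_eq_add hjd, ht' (j + 1) (by omega)] at h1
      omega
    have hlast : entry α.1 d ≠ entry β.1 d := by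
      intro h
      refine hαβ (Subtype.ext (ext_of_entry fun j hj hjd => ?_))
      rcases eq_or_ne j d with rfl | hne
      · exact h
      · exact hent j hj (by omega)
    have hm := hent (d - 1) (by omega) le_rfl
    have hα := α.2.2
    have hβ := β.2.2
    refine ⟨0, Nat.zero_le _, fun f hf => ?_⟩
    rw [harmonicFactor_zero, harmonicFactor_zero, ← hm]
    rcases hα with hα | ⟨hα, hα'⟩
    · rw [if_pos hα, if_neg (by omega)]
      exact hE.planarPair_fst_mul_snd hd (by omega) hf
    · rw [if_neg (by omega), if_pos (by omega), mul_comm (planarPair d _).2]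
      exact hE.planarPair_fst_mul_snd hd (by omega) hf
  have := IsGaussian.harmonicFactor_mul_lift h hl 1 (one_mem _)
  rwa [one_mul] at this

/-- The factor of `[h_α]²` that belongs to `α_j`. -/
def normFactor (α : Fin d → ℕ) (j : ℕ) : ℝ :=
  ((entry α j).factorial * poch (((d : ℝ) - j + 1) / 2) (tailSum α (j + 1)) *
      (((entry α j : ℕ) : ℝ) + lam α j)) /
    (poch (2 * lam α j) (entry α j) * poch (((d : ℝ) - j) / 2) (tailSum α (j + 1)) * lam α j)

theorem prod_Icc_succ {M : Type*} [CommMonoid M] (f : ℕ → M) {l : ℕ} (hl : l + 3 ≤ d) :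
    ∏ j ∈ Icc (d - 1 - (l + 1)) (d - 2), f j =
      f (d - 2 - l) * ∏ j ∈ Icc (d - 1 - l) (d - 2), f j := by
  rw [show d - 1 - (l + 1) = d - 2 - l by omega,
    ← Finset.insert_Icc_add_one_left_eq_Icc (show d - 2 - l ≤ d - 2 by omega),
    Finset.prod_insert (by simp), show d - 2 - l + 1 = d - 1 - l by omega]

/-- The right side is the expectation of `(x_1² + ⋯ + x_{l+2}²)^N`, with `N` the degree at level
`l`: each partial product of `[h_α]²` normalizes the polynomial on the sphere of its own level. -/
theorem IsGaussian.normFactor_mul_harmonicFactor_sq {E : MvPolynomial (Fin d) ℝ →ₗ[ℝ] ℝ}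
    (hE : IsGaussian E) {n : ℕ} (α : Index d n) {l : ℕ} (hl : l + 2 ≤ d) :
    ((if 0 < entry α.1 (d - 1) + entry α.1 d then 2 else 1) *
      ∏ j ∈ Icc (d - 1 - l) (d - 2), normFactor α.1 j) * E (harmonicFactor α.1 l ^ 2) =
    2 ^ tailSum α.1 (d - 1 - l) * poch (((l : ℝ) + 2) / 2) (tailSum α.1 (d - 1 - l)) := by
  induction l with
  | zero =>
    rw [tsub_zero, Finset.Icc_eq_empty (by omega), Finset.prod_empty, mul_one, tailSum_sub_one,
      harmonicFactor_zero, Nat.cast_zero, zero_add, div_self two_ne_zero]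
    -- The factor `b_α = 2` compensates the planar average `1/2`, except in degree zero.
    by_cases hm : entry α.1 (d - 1) = 0
    · have h0 : entry α.1 d = 0 := by
        rcases α.2.2 with h | ⟨-, h⟩
        · exact h
        · omega
      simp [hm, h0, planarPair_zero, hE.one, poch_zero]
    · have h := hE.planarPair_sq hl hm
      rw [if_pos (by omega)]
      split_ifs
      · exact h.1
      · exact h.2
  | succ l ih =>
    have ih := ih (by omega)
    have hq := harmonicFactor_isHarmonicOfDegree α.1 (l := l) (by omega)
    rw [prod_Icc_succ _ hl, harmonicFactor_succ, hE.homGegenbauer_mul_sq (by omega) hq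
      (lam_eq hl), tailSum_sub_add_two hl, normFactor,
      show d - 2 - l + 1 = d - 1 - l by omega]
    have hdl : (d : ℝ) - ((d - 2 - l : ℕ) : ℝ) = l + 2 := by
      rw [show d - 2 - l = d - (l + 2) by omega, Nat.cast_sub (by omega)]
      push_cast
      ring
    have hμ := lam_pos (α := α.1) hl
    have hμeq : lam α.1 (d - 2 - l) + 1 = ((l : ℝ) + 2 + 1) / 2 + tailSum α.1 (d - 1 - l) := by
      rw [lam_eq hl]
      push_cast
      ring
    rw [hdl]
    generalize entry α.1 (d - 2 - l) = a at *
    generalize tailSum α.1 (d - 1 - l) = N at *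
    generalize lam α.1 (d - 2 - l) = μ at *
    have e1 : poch ((((l + 1 : ℕ) : ℝ) + 2) / 2) (a + N) =
        poch (((l : ℝ) + 2 + 1) / 2) N * poch (μ + 1) a := by
      rw [add_comm a, poch_add, hμeq]
      push_cast
      ring_nf
    have e2 := poch_mul_add μ a
    have h1 := (poch_pos (a := 2 * μ) (by linarith) a).ne'
    have h2 := (poch_pos (a := ((l : ℝ) + 2) / 2) (by positivity) N).ne'
    have h3 : (a.factorial : ℝ) ≠ 0 := by positivity
    rw [e1, pow_add]
    generalize ∏ j ∈ Icc (d - 1 - l) (d - 2), normFactor α.1 j = Pr at *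
    generalize (if 0 < entry α.1 (d - 1) + entry α.1 d then (2 : ℝ) else 1) = b at *
    generalize E (harmonicFactor α.1 l ^ 2) = Q at *
    have e3 : b * (a.factorial * poch (((l : ℝ) + 2 + 1) / 2) N * (a + μ) /
        (poch (2 * μ) a * poch (((l : ℝ) + 2) / 2) N * μ) * Pr) *
        (2 ^ a * poch μ a * poch (2 * μ) a / a.factorial * Q) =
        (b * Pr * Q) * (poch (((l : ℝ) + 2 + 1) / 2) N * 2 ^ a * (poch μ a * (μ + a)) /
          (poch (((l : ℝ) + 2) / 2) N * μ)) := by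
      field_simp
      ring
    rw [e3, ih, e2]
    field_simp

theorem hSq_eq (α : Fin d → ℕ) : hSq α = (if 0 < entry α (d - 1) + entry α d then 2 else 1) *
    ∏ j ∈ Icc 1 (d - 2), normFactor α j := rfl

theorem hSq_nonneg (α : Fin d → ℕ) : 0 ≤ hSq α := by
  unfold hSq
  refine mul_nonneg (by split_ifs <;> norm_num) (Finset.prod_nonneg fun j hj => ?_)
  obtain ⟨h1, h2⟩ := Finset.mem_Icc.1 hj
  have hμ := lam_pos (α := α) (l := d - 2 - j) (by omega)
  rw [show d - 2 - (d - 2 - j) = j by omega] at hμ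
  have hdj : (0 : ℝ) < d - j := sub_pos.2 (Nat.cast_lt.2 (by omega))
  have p1 := poch_pos (a := ((d : ℝ) - j + 1) / 2) (by linarith) (tailSum α (j + 1))
  have p2 := poch_pos (a := 2 * lam α j) (by linarith) (entry α j)
  have p3 := poch_pos (a := ((d : ℝ) - j) / 2) (by linarith) (tailSum α (j + 1))
  positivity

/-! ### Evaluation in spherical coordinates -/

theorem eval_partialNormSq_sphericalPoint (r : ℝ) (θ : Fin (d - 1) → ℝ) {k : ℕ} (hk : k + 1 ≤ d) :
    eval (sphericalPoint d r θ) (partialNormSq d (k + 1)) =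
      (r * ∏ i ∈ Icc (k + 1) (d - 1), Real.sin (entry θ i)) ^ 2 := by
  have hx : ∀ i (hi : i < d), eval (sphericalPoint d r θ) (coordVar d i) =
      sphericalPoint d r θ ⟨i, hi⟩ := fun i hi => by simp [coordVar, hi]
  induction k with
  | zero =>
    simp [partialNormSq, hx 0 (by omega), sphericalPoint]
  | succ k ih =>
    rw [partialNormSq, Finset.sum_range_succ, ← partialNormSq, map_add, ih (by omega), map_pow,
      hx _ (by omega), sphericalPoint, if_neg (by simp),
      ← Finset.insert_Icc_add_one_left_eq_Icc (show k + 1 ≤ d - 1 by omega),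
      Finset.prod_insert (by simp)]
    linear_combination (r * ∏ i ∈ Icc (k + 1 + 1) (d - 1), Real.sin (entry θ i)) ^ 2 *
      Real.sin_sq_add_cos_sq (entry θ (k + 1))

/-- De Moivre's formula, since `x_2 + i x_1` is the planar radius times `e^{iθ_1}`. -/
theorem eval_planarPair_sphericalPoint (hd : 2 ≤ d) (r : ℝ) (θ : Fin (d - 1) → ℝ) (m : ℕ) :
    eval (sphericalPoint d r θ) (planarPair d m).1 =
        (r * ∏ i ∈ Icc 2 (d - 1), Real.sin (entry θ i)) ^ m * Real.cos (m * entry θ 1) ∧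
      eval (sphericalPoint d r θ) (planarPair d m).2 =
        (r * ∏ i ∈ Icc 2 (d - 1), Real.sin (entry θ i)) ^ m * Real.sin (m * entry θ 1) := by
  have h0 : eval (sphericalPoint d r θ) (coordVar d 0) =
      (r * ∏ i ∈ Icc 2 (d - 1), Real.sin (entry θ i)) * Real.sin (entry θ 1) := by
    rw [coordVar, dif_pos (by omega), eval_X, sphericalPoint, if_pos rfl,
      ← Finset.insert_Icc_add_one_left_eq_Icc (show 1 ≤ d - 1 by omega),
      Finset.prod_insert (by simp), one_add_one_eq_two]
    ring
  have h1 : eval (sphericalPoint d r θ) (coordVar d 1) =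
      (r * ∏ i ∈ Icc 2 (d - 1), Real.sin (entry θ i)) * Real.cos (entry θ 1) := by
    rw [coordVar, dif_pos (by omega), eval_X, sphericalPoint, if_neg (by simp)]
  induction m with
  | zero => simp [planarPair_zero]
  | succ m ih =>
    rw [planarPair_succ]
    simp only [map_add, map_sub, map_mul, h0, h1, ih.1, ih.2]
    push_cast
    rw [add_mul, one_mul, Real.cos_add, Real.sin_add]
    constructor <;> ring

/-- The radius at level `l` is the next radius times `sin θ_{l+2}`. Its power supplies the sine
factor, and homogeneity of the Gegenbauer factor supplies the missing power of the new radius. -/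
theorem eval_harmonicFactor_sphericalPoint (α : Fin d → ℕ) (r : ℝ) (θ : Fin (d - 1) → ℝ) {l : ℕ}
    (hl : l + 2 ≤ d) :
    eval (sphericalPoint d r θ) (harmonicFactor α l) =
      (r * ∏ i ∈ Icc (l + 2) (d - 1), Real.sin (entry θ i)) ^ tailSum α (d - 1 - l) *
        g α (entry θ 1) * ∏ j ∈ Icc (d - 1 - l) (d - 2),
          Real.sin (entry θ (d - j)) ^ tailSum α (j + 1) *
            gegenbauer (entry α j) (lam α j) (Real.cos (entry θ (d - j))) := by
  induction l with
  | zero =>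
    have h := eval_planarPair_sphericalPoint hl r θ (entry α (d - 1))
    rw [harmonicFactor_zero, tsub_zero, tailSum_sub_one, zero_add,
      Finset.Icc_eq_empty (show ¬d - 1 ≤ d - 2 by omega), Finset.prod_empty, mul_one, g]
    split_ifs
    · exact h.1
    · exact h.2
  | succ l ih =>
    have hx : eval (sphericalPoint d r θ) (coordVar d (l + 2)) =
        (r * ∏ i ∈ Icc (l + 3) (d - 1), Real.sin (entry θ i)) * Real.cos (entry θ (l + 2)) := by
      rw [coordVar, dif_pos (by omega), eval_X, sphericalPoint, if_neg (by simp)]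
    have hG := map_homGegenbauer (lam α (d - 2 - l)) (partialNormSq d (l + 3)) (coordVar d (l + 2))
      (aeval (sphericalPoint d r θ)) (entry α (d - 2 - l))
    have haeval : ∀ p, aeval (sphericalPoint d r θ) p = eval (sphericalPoint d r θ) p :=
      fun p => by rw [← coe_aeval_eq_eval]; rfl
    simp only [haeval] at hG
    rw [harmonicFactor_succ, map_mul, ih (by omega), hG,
      eval_partialNormSq_sphericalPoint r θ (k := l + 2) hl, hx, homGegenbauer_mul_sq_mul,
      homGegenbauer_eq_gegenbauer (lam_pos hl), prod_Icc_succ _ hl, tailSum_sub_add_two hl,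
      show d - (d - 2 - l) = l + 2 by omega, show d - 2 - l + 1 = d - 1 - l by omega,
      ← Finset.insert_Icc_add_one_left_eq_Icc (show l + 2 ≤ d - 1 by omega),
      Finset.prod_insert (by simp)]
    ring

/-! ### The orthonormal basis -/

/-- The polynomial whose values in spherical coordinates are given by `Y_α`. -/
def harmonicPolynomial {n : ℕ} (α : Index d n) : MvPolynomial (Fin d) ℝ :=
  h α.1 • harmonicFactor α.1 (d - 2)

theorem harmonicPolynomial_mem (hd : 2 < d) {n : ℕ} (α : Index d n) :
    harmonicPolynomial α ∈ harmonicSubmodule d n := by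
  have hH := harmonicFactor_isHarmonicOfDegree α.1 (l := d - 2) (by omega)
  rw [show d - 2 + 2 = d by omega, show d - 1 - (d - 2) = 1 by omega, α.2.1] at hH
  refine Submodule.smul_mem _ _ (Submodule.mem_inf.2 ⟨?_, ?_⟩)
  · exact (mem_homogeneousSubmodule _ _).2 hH.isHomogeneous
  · rw [LinearMap.mem_ker, laplacian_eq_partialLaplacian, hH.laplacian_eq_zero]

theorem eval_harmonicPolynomial (hd : 2 < d) {n : ℕ} (α : Index d n) (r : ℝ)
    (θ : Fin (d - 1) → ℝ) :
    eval (sphericalPoint d r θ) (harmonicPolynomial α) = Y α.1 r θ := by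
  rw [harmonicPolynomial, smul_eval, eval_harmonicFactor_sphericalPoint α.1 r θ (by omega), Y,
    show d - 1 - (d - 2) = 1 by omega, Finset.Icc_eq_empty (show ¬d - 2 + 2 ≤ d - 1 by omega),
    Finset.prod_empty, mul_one]
  ring

theorem isHomogeneous_of_mem_harmonicSubmodule {n : ℕ} {p : MvPolynomial (Fin d) ℝ}
    (hp : p ∈ harmonicSubmodule d n) : p.IsHomogeneous n :=
  (mem_homogeneousSubmodule _ _).1 (Submodule.mem_inf.1 hp).1

theorem sphereInner_harmonicPolynomial_self (hd : 2 < d) {n : ℕ} (α : Index d n) :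
    sphereInner d (harmonicPolynomial α) (harmonicPolynomial α) = 1 := by
  have hhom := isHomogeneous_of_mem_harmonicSubmodule (harmonicPolynomial_mem hd α)
  have hN := isGaussian_gaussianExpectation.normFactor_mul_harmonicFactor_sq α
    (l := d - 2) (by omega)
  have hcast : ((d - 2 : ℕ) : ℝ) + 2 = d := by
    rw [Nat.cast_sub (by omega)]
    push_cast
    ring
  rw [show d - 1 - (d - 2) = 1 by omega, α.2.1, hcast, ← hSq_eq] at hN
  have hpos := poch_pos (a := (d : ℝ) / 2) (by positivity) n
  rw [sphereInner_eq (by omega) hhom hhom, harmonicPolynomial, smul_mul_smul_comm, map_smul, h,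
    Real.mul_self_sqrt (hSq_nonneg _), isGaussian_gaussianExpectation.partialNormSq_pow le_rfl,
    smul_eq_mul, ← pow_two, ← hN]
  refine div_self (ne_of_gt ?_)
  rw [hN]
  positivity

theorem sphereInner_harmonicPolynomial_of_ne (hd : 2 < d) {n : ℕ} {α β : Index d n}
    (hαβ : α ≠ β) : sphereInner d (harmonicPolynomial α) (harmonicPolynomial β) = 0 := by
  rw [sphereInner_eq (by omega)
    (isHomogeneous_of_mem_harmonicSubmodule (harmonicPolynomial_mem hd α))
    (isHomogeneous_of_mem_harmonicSubmodule (harmonicPolynomial_mem hd β)), harmonicPolynomial,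
    harmonicPolynomial, smul_mul_smul_comm, map_smul,
    isGaussian_gaussianExpectation.harmonicFactor_mul_eq_zero (by omega) hαβ, smul_zero, zero_div]

theorem linearIndependent_harmonicPolynomial (hd : 2 < d) (n : ℕ) :
    LinearIndependent ℝ fun α : Index d n =>
      (⟨harmonicPolynomial α, harmonicPolynomial_mem hd α⟩ : harmonicSubmodule d n) := by
  refine LinearIndependent.of_comp (harmonicSubmodule d n).subtype ?_
  rw [linearIndependent_iff']
  intro s c hc β hβ
  have h1 := congrArg (fun p => gaussianExpectation d (p * harmonicPolynomial β)) hc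
  simp only [Function.comp_apply, Submodule.subtype_apply, Finset.sum_mul, map_sum,
    smul_mul_assoc, map_smul, zero_mul, map_zero] at h1
  have horth : ∀ α : Index d n, α ≠ β →
      gaussianExpectation d (harmonicPolynomial α * harmonicPolynomial β) = 0 := by
    intro α hαβ
    rw [harmonicPolynomial, harmonicPolynomial, smul_mul_smul_comm, map_smul,
      isGaussian_gaussianExpectation.harmonicFactor_mul_eq_zero (by omega) hαβ, smul_zero]
  rw [Finset.sum_eq_single_of_mem β hβ fun α _ hαβ => by rw [horth α hαβ, smul_zero]] at h1
  -- A vanishing Gaussian norm would make the sphere norm zero rather than one.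
  refine (smul_eq_zero.1 h1).resolve_right fun h0 => ?_
  have hself := sphereInner_harmonicPolynomial_self hd β
  have hhom := isHomogeneous_of_mem_harmonicSubmodule (harmonicPolynomial_mem hd β)
  rw [sphereInner_eq (by omega) hhom hhom, h0, zero_div] at hself
  exact zero_ne_one hself

/-- The injection `indexCoeff` bounds the dimension by the number of indices, so the independent
family spans. -/
theorem span_harmonicPolynomial_eq_top (hd : 2 < d) (n : ℕ) :
    Submodule.span ℝ (Set.range fun α : Index d n =>
      (⟨harmonicPolynomial α, harmonicPolynomial_mem hd α⟩ : harmonicSubmodule d n)) = ⊤ := by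
  have : Fintype (Index d n) := Fintype.ofFinite _
  have hinj := indexCoeff_injective (d := d) (by omega) n
  have : FiniteDimensional ℝ (harmonicSubmodule d n) := FiniteDimensional.of_injective _ hinj
  have hli := linearIndependent_harmonicPolynomial hd n
  refine hli.span_eq_top_of_card_eq_finrank' (le_antisymm hli.fintype_card_le_finrank ?_)
  simpa using LinearMap.finrank_le_finrank_of_injective hinj

end SphericalHarmonics

end

open SphericalHarmonics in
theorem mainTheorem8 (d : ℕ) (hd : 2 < d) (n : ℕ) :
    ∃ B : Module.Basis (Index d n) ℝ (harmonicSubmodule d n),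
      (∀ (α : Index d n) (r : ℝ) (θ : Fin (d - 1) → ℝ), 0 ≤ r → θ ∈ angleDomain d →
        MvPolynomial.eval (sphericalPoint d r θ) (B α : MvPolynomial (Fin d) ℝ) = Y α.1 r θ) ∧
      (∀ α : Index d n, sphereInner d (B α) (B α) = 1) ∧
      (∀ α β : Index d n, α ≠ β → sphereInner d (B α) (B β) = 0) := by
  refine ⟨Module.Basis.mk (linearIndependent_harmonicPolynomial hd n)
    (span_harmonicPolynomial_eq_top hd n).ge, ?_, ?_, ?_⟩
  · intro α r θ _ _
    rw [Module.Basis.mk_apply]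
    exact eval_harmonicPolynomial hd α r θ
  · intro α
    rw [Module.Basis.mk_apply]
    exact sphereInner_harmonicPolynomial_self hd α
  · intro α β hαβ
    rw [Module.Basis.mk_apply, Module.Basis.mk_apply]
    exact sphereInner_harmonicPolynomial_of_ne hd hαβ
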